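/- Write $u=4-s-t$. Let $F$ be holomorphic on the Mandelstam domain $\mathbb{C}^2_{cut}=\{(s,t)\in\mathbb{C}^2 : s,t,u\notin[4,\infty)\}$, and assume the following. (1) $F$ is real analytic, $F(\bar s,\bar t)=\overline{F(s,t)}$. (2) $F$ is polynomially bounded, $|F(s,t)|\le \mathrm{const}\,(1+|s|+|t|)^n$ on $\mathbb{C}^2_{cut}$, and its boundary values are Hölder continuous with an index $\mu\in(0,\tfrac12]$: for each choice of the signs of $\mathrm{Im}\,s,\mathrm{Im}\,t,\mathrm{Im}\,u$, the restriction of $F$ to the corresponding tube extends to the closed tube, and the extension is Hölder continuous with index $\mu$ on bounded sets. (3) $F$ is crossing symmetric, $F(s,t)=F(t,s)=F(s,u)=F(u,s)=F(u,t)=F(t,u)$. (4) The absorptive part $F_s(s,t)=(2i)^{-1}\big(F(s+i0,t)-F(s-i0,t)\big)$ satisfies $|F_s(s,t)|\le \mathrm{const}\,\sqrt{\tfrac{s-4}{s}}\,(1+|s|+|t|)^n$ for some $n$, for all real $s\ge4$ and all $t\in\mathbb{C}\setminus\big((-\infty,-s]\cup[4,\infty)\big)$ (and hence also for its boundary values at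 $t\pm i0$). (5) The cuts in $t$ and $u$ start at $t_1\ge4$: $F$ is holomorphic on $\{s\notin[4,\infty),\ t\notin[t_1,\infty),\ u\notin[t_1,\infty)\}$. (6) If $t_1=4$, then $F$ has Mandelstam analyticity in the precise form $F(s,t)=G(s,t)+G(t,s)+G(s,u)+G(u,s)+G(u,t)+G(t,u)$ on $\mathbb{C}^2_{cut}$, with a polynomially bounded holomorphic function $G$ on $\{(s,t)\in\mathbb{C}^2: s\notin[4,\infty),\ t\notin[16,\infty)\}$. Let $$f_l(s)=\tfrac12[s(s-4)]^{-1/2}\int_{4-s}^0F(s+i0,t)\,P_l\Big(1+\frac{2t}{s-4}\Big)dt\quad(s>4)$$ be the partial wave amplitudes of $F$, where $P_l$ is the Legendre polynomial, and let $$\Phi_l^\mu(v;s)=\int_v^{v+1}(t-v)^\mu\,Q_l\Big(1+\frac{2t}{s-4}\Big)dt\quad(s>4),\qquad \Phi_l^\mu(v;4)=0,$$ where $Q_l(z)=\tfrac12\int_{-1}^1\frac{P_l(x)}{z-x}dx$ ($z>1$) is the Legendre function of the second kind. At $s=4$ put $f_l(4)=0$ (the threshold limit), and read the right-hand side of the first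 estimate below as $0$. Then for every finite $s_1\ge4$ there are constants $c_1,c_2\ge0$, and for every $\gamma\in\mathbb{R}$ a constant $c_3\ge0$, such that for all $l=0,1,2,\dots$ and all $s$ with $4\le s\le s_1$: $$|f_l(s)|\le c_1\Big(\frac{s-4}{s}\Big)^{-1/2}\Phi_l^\mu(t_1;s),\qquad |\mathrm{Im}\,f_l(s)|\le c_2\,\Phi_l^\mu(t_1;s),$$ $$\mathrm{Im}\,f_l(s)-2|f_l(s)|^2\ge -c_3\,s^\gamma\,\Phi_l^\mu(t_1;s).$$ -/

import Mathlib

open scoped Topology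

noncomputable section

/-- The cut `[c, ∞)` on the real axis of the complex plane. -/
def cut (c : ℝ) : Set ℂ := {z | z.im = 0 ∧ c ≤ z.re}

/-- Pairs `(s, t)` such that `s`, `t` and `u = 4 - s - t` avoid the cuts
`[a, ∞)`, `[b, ∞)` and `[c, ∞)` respectively. -/
def cutDomain (a b c : ℝ) : Set (ℂ × ℂ) :=
  {p | p.1 ∉ cut a ∧ p.2 ∉ cut b ∧ 4 - p.1 - p.2 ∉ cut c}

/-- The Mandelstam domain. The condition `s + t ∉ (-∞, 0]` is `u ∉ [4, ∞)`. -/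
def mandelstamDomain : Set (ℂ × ℂ) := cutDomain 4 4 4

/-- The domain `s ∉ [4, ∞)`, `t ∉ [16, ∞)`. -/
def mandelstamHalfDomain : Set (ℂ × ℂ) := {p | p.1 ∉ cut 4 ∧ p.2 ∉ cut 16}

/-- `G` is bounded on `D` by `C * (1 + |s| + |t|) ^ n` for some `C` and `n`. -/
def PolynomiallyBoundedOn (G : ℂ → ℂ → ℂ) (D : Set (ℂ × ℂ)) : Prop :=
  ∃ (C : ℝ) (n : ℕ), ∀ s t : ℂ, (s, t) ∈ D → ‖G s t‖ ≤ C * (1 + ‖s‖ + ‖t‖) ^ n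

/-- The tube on which `Im s`, `Im t`, `Im u` have the signs of `a`, `b`, `c`. -/
def tube (a b c : ℝ) : Set (ℂ × ℂ) :=
  {p | 0 < a * p.1.im ∧ 0 < b * p.2.im ∧ 0 < c * (4 - p.1 - p.2).im}

/-- Boundary values are Hölder continuous with index `μ`: from each of the sides of the cuts
(each choice of the signs of `Im s`, `Im t`, `Im u`) the function `F` extends to the closed
tube, and the extension is Hölder continuous with index `μ` on bounded sets. -/
def HasHolderBoundaryValues (μ : ℝ) (F : ℂ → ℂ → ℂ) : Prop :=
  ∀ a ∈ ({1, -1} : Set ℝ), ∀ b ∈ ({1, -1} : Set ℝ), ∀ c ∈ ({1, -1} : Set ℝ),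
    ∃ B : ℂ × ℂ → ℂ, (∀ p ∈ tube a b c, B p = F p.1 p.2) ∧
      ∀ R : ℝ, ∃ C : ℝ, ∀ p ∈ closure (tube a b c), ∀ q ∈ closure (tube a b c),
        ‖p‖ ≤ R → ‖q‖ ≤ R → ‖B p - B q‖ ≤ C * ‖p - q‖ ^ μ

/-- Amplitudes: Mandelstam analyticity with real analyticity, polynomial boundedness with
Hölder continuous boundary values of index `μ`, and full `s`-`t`-`u` crossing symmetry. -/
structure IsAmplitude (μ : ℝ) (F : ℂ → ℂ → ℂ) : Prop where
  holomorphic : DifferentiableOn ℂ (fun p : ℂ × ℂ => F p.1 p.2) mandelstamDomain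
  real_analytic : ∀ s t : ℂ, (s, t) ∈ mandelstamDomain →
    F (starRingEnd ℂ s) (starRingEnd ℂ t) = starRingEnd ℂ (F s t)
  bounded : PolynomiallyBoundedOn F mandelstamDomain
  holder : HasHolderBoundaryValues μ F
  crossing : ∀ s t : ℂ, (s, t) ∈ mandelstamDomain →
    F s t = F t s ∧ F s t = F s (4 - s - t) ∧ F s t = F (4 - s - t) s ∧
      F s t = F (4 - s - t) t ∧ F s t = F t (4 - s - t)

/-- `F(s + i0, t)`. -/
def above (F : ℂ → ℂ → ℂ) (s : ℝ) (t : ℂ) : ℂ :=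
  Filter.limUnder (𝓝[>] (0 : ℝ)) (fun ε : ℝ => F (s + ε * Complex.I) t)

/-- `F(s - i0, t)`. -/
def below (F : ℂ → ℂ → ℂ) (s : ℝ) (t : ℂ) : ℂ :=
  Filter.limUnder (𝓝[>] (0 : ℝ)) (fun ε : ℝ => F (s - ε * Complex.I) t)

/-- The absorptive part `F_s(s, t) = (F(s + i0, t) - F(s - i0, t)) / (2 i)`. -/
def absorptivePart (F : ℂ → ℂ → ℂ) (s : ℝ) (t : ℂ) : ℂ :=
  (above F s t - below F s t) / (2 * Complex.I)

/-- The threshold bound on the `s`-channel absorptive part, for `s ≥ 4` and `t` in the plane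
cut along `(-∞, -s]` and `[4, ∞)`. By continuity the bound passes to the boundary values at
`t ± i0`. -/
def HasThresholdBound (F : ℂ → ℂ → ℂ) : Prop :=
  ∃ (C : ℝ) (n : ℕ), ∀ (s : ℝ) (t : ℂ), 4 ≤ s → t ∉ cut 4 → 4 - (s : ℂ) - t ∉ cut 4 →
    ‖absorptivePart F s t‖ ≤ C * √((s - 4) / s) * (1 + |s| + ‖t‖) ^ n

/-- The crossing symmetrization `Sym G`. -/
def crossingSym (G : ℂ → ℂ → ℂ) (s t : ℂ) : ℂ :=
  G s t + G t s + G s (4 - s - t) + G (4 - s - t) s + G (4 - s - t) t + G t (4 - s - t)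

/-- The precise form of Mandelstam analyticity and crossing symmetry: `F = Sym G` with a
polynomially bounded `G`, holomorphic for `s ∉ [4, ∞)`, `t ∉ [16, ∞)`. -/
def HasMandelstamForm (F : ℂ → ℂ → ℂ) : Prop :=
  ∃ G : ℂ → ℂ → ℂ,
    DifferentiableOn ℂ (fun p : ℂ × ℂ => G p.1 p.2) mandelstamHalfDomain ∧
    PolynomiallyBoundedOn G mandelstamHalfDomain ∧
    ∀ s t : ℂ, (s, t) ∈ mandelstamDomain → F s t = crossingSym G s t

/-- The Legendre polynomial `P_l`. Mathlib's shifted polynomial is `x ↦ P_l (1 - 2 x)`. -/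
def legendreP (l : ℕ) (z : ℝ) : ℝ :=
  Polynomial.aeval ((1 - z) / 2) (Polynomial.shiftedLegendre l)

/-- The Legendre function of the second kind `Q_l (z)`, `z > 1`, by Neumann's formula. -/
def legendreQ (l : ℕ) (z : ℝ) : ℝ :=
  (1 / 2) * ∫ x in (-1 : ℝ)..1, legendreP l x / (z - x)

/-- The partial wave amplitude
`f_l(s) = (1/2) [s (s - 4)]^(-1/2) ∫_{4-s}^0 F(s + i0, t) P_l(1 + 2t/(s - 4)) dt`
for `s > 4`. At `s = 4` this expression evaluates to `0`, the threshold limit of `f_l`. -/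
def partialWave (F : ℂ → ℂ → ℂ) (l : ℕ) (s : ℝ) : ℂ :=
  (((1 / 2) * (s * (s - 4)) ^ (-(1 / 2) : ℝ) : ℝ) : ℂ) *
    ∫ t in (4 - s)..0, above F s (t : ℂ) * ((legendreP l (1 + 2 * t / (s - 4)) : ℝ) : ℂ)

/-- The function `Φ_l^μ(v; s)`, the weighted integral of `Q_l`. -/
def Phi (μ : ℝ) (l : ℕ) (v s : ℝ) : ℝ :=
  if s = 4 then 0
  else ∫ t in v..(v + 1), (t - v) ^ μ * legendreQ l (1 + 2 * t / (s - 4))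

end

/-!
Fix `s > 4`, put `z = cos θ = 1 + 2 t / (s - 4)`, and let `a` be the boundary value of `F` at
`s + i0` as a function of `z` in the closed upper half plane. By the crossing `t ↔ u`, its value from
below the real axis is `a (-z)`, and the two sides agree between the cuts
(`boundaryValue_crossing`). Cauchy's formula on the square with corners `± X ± i X`, where `X`
corresponds to `t = t₁ + 1`, represents `a` on `[-1, 1]` by an integral over the square and an
integral of the jump `a x - a (-x)` over the part of the cut inside it. Projected on `P_l`, the
Cauchy kernel becomes a Neumann integral, which Rodrigues' formula bounds by `Q_l`
(`norm_integral_mul_legendreP_le`). The jump is `O((t - t₁) ^ μ)` by Hölder continuity, so its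
contribution is at most a multiple of `Φ`; on the square the kernel is at most a multiple of
`Q_l X ≤ (μ + 1) Φ`. As the contour is finite, no subtractions are needed, and the bound is uniform in
`l`. This is `exists_norm_partialWave_le`.

Away from `s = 4` the bound for `Im f_l` follows from the one for `f_l`. Near threshold there are
two cases. If `t₁ > 4`, crossing removes the `s`-cut below `t₁`, and `f_l` is real
(`partialWave_im_eq_zero`). If `t₁ = 4`, Mandelstam's form shows that the absorptive part has no
jump in `t` below `16` as long as `s < 16` (`re_jump_eq_zero`); the same contour estimate then
applies to it without a jump term, and the threshold bound on the square supplies the factor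
`√((s - 4) / s)` that cancels the phase space factor (`exists_abs_im_partialWave_le`). The lower bound
on `Im f_l - 2 |f_l|²` follows from the first two estimates and `Φ ≤ (s - 4) / 8`.
-/

open Filter MeasureTheory Set

/-! ### Neumann integrals and Legendre functions of the second kind -/

/-- One integration by parts, without boundary terms. -/
theorem integral_derivative_div_pow (p : Polynomial ℂ) (c : ℂ) (k : ℕ)
    (hc : ∀ y ∈ Icc (0 : ℝ) 1, c + 2 * (y : ℂ) ≠ 0) (h0 : p.eval 0 = 0) (h1 : p.eval 1 = 0) :
    ∫ y in (0 : ℝ)..1, p.derivative.eval (y : ℂ) / (c + 2 * (y : ℂ)) ^ (k + 1) =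
      2 * (k + 1) * ∫ y in (0 : ℝ)..1, p.eval (y : ℂ) / (c + 2 * (y : ℂ)) ^ (k + 2) := by
  have hu : uIcc (0 : ℝ) 1 = Icc 0 1 := uIcc_of_le zero_le_one
  have hd : ∀ y ∈ uIcc (0 : ℝ) 1, HasDerivAt
      (fun y : ℝ => p.eval (y : ℂ) / (c + 2 * (y : ℂ)) ^ (k + 1))
      (p.derivative.eval (y : ℂ) / (c + 2 * (y : ℂ)) ^ (k + 1) -
        2 * (k + 1) * (p.eval (y : ℂ) / (c + 2 * (y : ℂ)) ^ (k + 2))) y := by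
    intro y hy
    rw [hu] at hy
    have hne := hc y hy
    have e1 : HasDerivAt (fun z : ℂ => c + 2 * z) 2 (y : ℂ) := by
      simpa using ((hasDerivAt_id (y : ℂ)).const_mul 2).const_add c
    have e2 := ((p.hasDerivAt (y : ℂ)).div (e1.pow (k + 1)) (pow_ne_zero _ hne)).comp_ofReal
    refine e2.congr_deriv ?_
    simp only [Pi.pow_apply]
    field_simp
    push_cast
    ring
  have c0 : ContinuousOn (fun y : ℝ => c + 2 * (y : ℂ)) (uIcc 0 1) := by fun_prop
  have cp : ∀ (q : Polynomial ℂ) (j : ℕ), ContinuousOn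
      (fun y : ℝ => q.eval (y : ℂ) / (c + 2 * (y : ℂ)) ^ j) (uIcc 0 1) := fun q j =>
    ContinuousOn.div (by fun_prop) (c0.pow j) fun y hy => pow_ne_zero _ (hc y (hu ▸ hy))
  have i1 := (cp p.derivative (k + 1)).intervalIntegrable (μ := volume)
  have i2 := ((cp p (k + 2)).intervalIntegrable (μ := volume)).const_mul (2 * (k + 1) : ℂ)
  have := intervalIntegral.integral_eq_sub_of_hasDerivAt hd (i1.sub i2)
  rw [intervalIntegral.integral_sub i1 i2, intervalIntegral.integral_const_mul] at this
  simp [h0, h1] at this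
  exact sub_eq_zero.1 this

theorem integral_iterate_derivative_div (l : ℕ) (c : ℂ)
    (hc : ∀ y ∈ Icc (0 : ℝ) 1, c + 2 * (y : ℂ) ≠ 0) {k : ℕ} (hk : k ≤ l) :
    ∫ y in (0 : ℝ)..1, (Polynomial.derivative^[l]
        ((Polynomial.X ^ l * (1 - Polynomial.X) ^ l : Polynomial ℂ))).eval (y : ℂ) /
        (c + 2 * (y : ℂ)) =
      2 ^ k * k.factorial * ∫ y in (0 : ℝ)..1, (Polynomial.derivative^[l - k]
        ((Polynomial.X ^ l * (1 - Polynomial.X) ^ l : Polynomial ℂ))).eval (y : ℂ) /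
        (c + 2 * (y : ℂ)) ^ (k + 1) := by
  induction k with
  | zero => simp
  | succ k ih =>
    rw [ih (by omega)]
    set w : Polynomial ℂ := Polynomial.X ^ l * (1 - Polynomial.X) ^ l with hw
    have hroot : ∀ x : ℂ, (Polynomial.X - Polynomial.C x) ^ l ∣ w →
        (Polynomial.derivative^[l - (k + 1)] w).eval x = 0 := by
      intro x hx
      have h := Polynomial.pow_sub_dvd_iterate_derivative_of_pow_dvd (l - (k + 1)) hx
      have h2 : (Polynomial.X - Polynomial.C x) ∣ (Polynomial.derivative^[l - (k + 1)] w) :=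
        (dvd_pow_self _ (by omega)).trans h
      exact Polynomial.dvd_iff_isRoot.1 h2
    have h0 := hroot 0 (by simp [hw])
    have h1 := hroot 1 (by
      rw [hw, show (1 - Polynomial.X : Polynomial ℂ) = -(Polynomial.X - Polynomial.C 1) by simp,
        neg_pow]
      exact Dvd.intro_left (Polynomial.X ^ l * (-1) ^ l) (by ring))
    have e : l - k = (l - (k + 1)) + 1 := by omega
    rw [e, Function.iterate_succ_apply', integral_derivative_div_pow _ c k hc h0 h1,
      Nat.factorial_succ]
    push_cast
    ring

/-- Rodrigues' formula and `l` integrations by parts, in the variable `y = (1 - x) / 2`. -/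
theorem integral_legendreP_div_sub (l : ℕ) (w : ℂ) (hw : 1 < ‖w‖) :
    ∫ x in (-1 : ℝ)..1, (legendreP l x : ℂ) / (w - x) =
      2 ^ (l + 1) * ∫ y in (0 : ℝ)..1,
        ((y : ℂ) * (1 - y)) ^ l / (w - 1 + 2 * (y : ℂ)) ^ (l + 1) := by
  have hc : ∀ y ∈ Icc (0 : ℝ) 1, w - 1 + 2 * (y : ℂ) ≠ 0 := by
    intro y hy h
    have : w = ((1 - 2 * y : ℝ) : ℂ) := by push_cast; linear_combination h
    rw [this, Complex.norm_real, Real.norm_eq_abs] at hw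
    exact absurd (abs_le.2 ⟨by linarith [hy.2], by linarith [hy.1]⟩) (not_le.2 hw)
  have h := integral_iterate_derivative_div l (w - 1) hc le_rfl
  have hP : ∀ y : ℝ, (l.factorial : ℂ) * (legendreP l (1 - 2 * y) : ℂ) =
      (Polynomial.derivative^[l]
        ((Polynomial.X ^ l * (1 - Polynomial.X) ^ l : Polynomial ℂ))).eval (y : ℂ) := by
    intro y
    have h1 := congrArg (Polynomial.map (Int.castRingHom ℂ))
      (Polynomial.factorial_mul_shiftedLegendre_eq l)
    rw [← Polynomial.iterate_derivative_map] at h1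
    simp only [Polynomial.map_mul, Polynomial.map_natCast, Polynomial.map_pow, Polynomial.map_X,
      Polynomial.map_sub, Polynomial.map_one] at h1
    rw [← h1, Polynomial.eval_mul, Polynomial.eval_natCast, legendreP]
    congr 1
    rw [show (1 - (1 - 2 * y)) / 2 = y by ring, Polynomial.eval_map, ← algebraMap_int_eq,
      ← Polynomial.aeval_def]
    exact (Polynomial.aeval_algebraMap_apply ℂ y (Polynomial.shiftedLegendre l)).symm
  have hfac : (l.factorial : ℂ) ≠ 0 := by exact_mod_cast l.factorial_ne_zero
  have hsub : ∫ x in (-1 : ℝ)..1, (legendreP l x : ℂ) / (w - x) =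
      2 * ∫ y in (0 : ℝ)..1, (legendreP l (1 - 2 * y) : ℂ) / (w - 1 + 2 * (y : ℂ)) := by
    have := intervalIntegral.smul_integral_comp_sub_mul
      (fun x : ℝ => (legendreP l x : ℂ) / (w - x)) (a := 0) (b := 1) (2 : ℝ) 1
    norm_num at this
    rw [← this]
    congr 2
    ext y
    ring
  rw [hsub, pow_succ, mul_comm ((2 : ℂ) ^ l), mul_assoc]
  congr 1
  apply mul_left_cancel₀ hfac
  rw [← intervalIntegral.integral_const_mul]
  simp only [← mul_div_assoc, hP, h]
  simp only [Nat.sub_self, Function.iterate_zero, id, Polynomial.eval_mul, Polynomial.eval_pow,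
    Polynomial.eval_sub, Polynomial.eval_one, Polynomial.eval_X, mul_pow]
  ring

theorem legendreQ_eq (l : ℕ) {r : ℝ} (hr : 1 < r) :
    legendreQ l r =
      2 ^ l * ∫ y in (0 : ℝ)..1, (y * (1 - y)) ^ l / (r - 1 + 2 * y) ^ (l + 1) := by
  have h := integral_legendreP_div_sub l (r : ℂ)
    (by rw [Complex.norm_real, Real.norm_eq_abs]; exact hr.trans_le (le_abs_self r))
  have h1 : ∀ x : ℝ, (legendreP l x : ℂ) / ((r : ℂ) - x) =
      ((legendreP l x / (r - x) : ℝ) : ℂ) := fun x => by push_cast; rfl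
  have h2 : ∀ y : ℝ, ((y : ℂ) * (1 - y)) ^ l / ((r : ℂ) - 1 + 2 * (y : ℂ)) ^ (l + 1) =
      (((y * (1 - y)) ^ l / (r - 1 + 2 * y) ^ (l + 1) : ℝ) : ℂ) := fun y => by push_cast; rfl
  simp only [h1, h2, intervalIntegral.integral_ofReal] at h
  have h3 : ∫ x in (-1 : ℝ)..1, legendreP l x / (r - x) =
      2 ^ (l + 1) * ∫ y in (0 : ℝ)..1, (y * (1 - y)) ^ l / (r - 1 + 2 * y) ^ (l + 1) := by
    exact_mod_cast h
  rw [legendreQ, h3]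
  ring

theorem continuousOn_rodrigues (l : ℕ) {r : ℝ} (hr : 1 < r) :
    ContinuousOn (fun y : ℝ => (y * (1 - y)) ^ l / (r - 1 + 2 * y) ^ (l + 1)) (uIcc 0 1) := by
  refine ContinuousOn.div (by fun_prop) (by fun_prop) fun y hy => pow_ne_zero _ ?_
  rw [uIcc_of_le zero_le_one] at hy
  exact (by linarith [hy.1] : 0 < r - 1 + 2 * y).ne'

theorem legendreQ_nonneg (l : ℕ) {r : ℝ} (hr : 1 < r) : 0 ≤ legendreQ l r := by
  rw [legendreQ_eq l hr]
  refine mul_nonneg (by positivity) (intervalIntegral.integral_nonneg zero_le_one fun y hy => ?_)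
  have h1 : 0 ≤ y * (1 - y) := mul_nonneg hy.1 (by linarith [hy.2])
  have h2 : 0 < r - 1 + 2 * y := by linarith [hy.1]
  positivity

theorem legendreQ_anti (l : ℕ) {r r' : ℝ} (hr : 1 < r) (h : r ≤ r') :
    legendreQ l r' ≤ legendreQ l r := by
  rw [legendreQ_eq l hr, legendreQ_eq l (hr.trans_le h)]
  refine mul_le_mul_of_nonneg_left (intervalIntegral.integral_mono_on zero_le_one
    (continuousOn_rodrigues l (hr.trans_le h)).intervalIntegrable
    (continuousOn_rodrigues l hr).intervalIntegrable fun y hy => ?_) (by positivity)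
  have h1 : 0 ≤ y * (1 - y) := mul_nonneg hy.1 (by linarith [hy.2])
  have h2 : 0 < r - 1 + 2 * y := by linarith [hy.1]
  gcongr

/-- A bound uniform in `l`: in Rodrigues' form `2 y (1 - y) ≤ r - 1 + 2 y`. -/
theorem legendreQ_le (l : ℕ) {r : ℝ} (hr : 1 < r) : legendreQ l r ≤ 1 / (r - 1) := by
  rw [legendreQ_eq l hr, ← intervalIntegral.integral_const_mul]
  have hc : IntervalIntegrable
      (fun y : ℝ => 2 ^ l * ((y * (1 - y)) ^ l / (r - 1 + 2 * y) ^ (l + 1))) volume 0 1 :=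
    (continuousOn_rodrigues l hr).intervalIntegrable.const_mul _
  calc _ ≤ ∫ y in (0 : ℝ)..1, 1 / (r - 1) := by
        refine intervalIntegral.integral_mono_on zero_le_one hc
          intervalIntegrable_const fun y hy => ?_
        have hr' : 0 < r - 1 := by linarith
        have h1 : 0 ≤ y * (1 - y) := mul_nonneg hy.1 (by linarith [hy.2])
        have h2 : 0 < r - 1 + 2 * y := by linarith [hy.1]
        have h3 : 2 * (y * (1 - y)) ≤ r - 1 + 2 * y := by nlinarith [hy.1, hy.2]
        rw [← mul_div_assoc, ← mul_pow, pow_succ, div_mul_eq_div_div, ← div_pow]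
        have h4 : (2 * (y * (1 - y)) / (r - 1 + 2 * y)) ^ l ≤ 1 :=
          pow_le_one₀ (by positivity) ((div_le_one h2).2 h3)
        exact div_le_div₀ zero_le_one h4 hr' (by linarith [hy.1])
    _ = _ := by simp

/-- On the circle of radius `ρ > 1` the Neumann integral of `P_l` is controlled by its value at
`ρ`: in Rodrigues' form the denominator is at least `ρ - |x|`. -/
theorem norm_integral_legendreP_div_sub_le (l : ℕ) (w : ℂ) (hw : 1 < ‖w‖) :
    ‖∫ x in (-1 : ℝ)..1, (legendreP l x : ℂ) / (w - x)‖ ≤ 4 * legendreQ l ‖w‖ := by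
  set r := ‖w‖ with hr
  rw [integral_legendreP_div_sub l w hw, norm_mul, legendreQ_eq l hw]
  set g : ℝ → ℝ := fun y => (y * (1 - y)) ^ l / (r - 1 + 2 * y) ^ (l + 1) with hg
  have hi := (continuousOn_rodrigues l hw).intervalIntegrable (μ := volume)
  have hsymm : ∫ y in (0 : ℝ)..1, g (1 - y) = ∫ y in (0 : ℝ)..1, g y := by
    simp
  have hi' : IntervalIntegrable (fun y => g (1 - y)) volume 0 1 := by
    simpa [hg] using (hi.comp_sub_left 1).symm
  have hb : ‖∫ y in (0 : ℝ)..1, ((y : ℂ) * (1 - y)) ^ l / (w - 1 + 2 * (y : ℂ)) ^ (l + 1)‖ ≤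
      ∫ y in (0 : ℝ)..1, (g y + g (1 - y)) := by
    refine intervalIntegral.norm_integral_le_of_norm_le zero_le_one (ae_of_all _ fun y hy => ?_)
      (hi.add hi')
    have h1 : 0 ≤ y * (1 - y) := mul_nonneg hy.1.le (by linarith [hy.2])
    have h1' : 0 ≤ (1 - y) * (1 - (1 - y)) := by linarith
    have h2 : 0 < r - 1 + 2 * y := by linarith [hy.1]
    have h3 : 0 < r - 1 + 2 * (1 - y) := by linarith [hy.2]
    have g0 : 0 ≤ g y := by simp only [hg]; positivity
    have g1 : 0 ≤ g (1 - y) := by simp only [hg]; positivity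
    have hn : ‖(y : ℂ) * (1 - y)‖ = y * (1 - y) := by
      rw [show (y : ℂ) * (1 - y) = ((y * (1 - y) : ℝ) : ℂ) by push_cast; rfl, Complex.norm_real,
        Real.norm_of_nonneg h1]
    have hd : r - |1 - 2 * y| ≤ ‖w - 1 + 2 * (y : ℂ)‖ := by
      have := norm_sub_norm_le w ((1 - 2 * y : ℝ) : ℂ)
      rw [Complex.norm_real, Real.norm_eq_abs] at this
      refine this.trans (le_of_eq ?_)
      congr 1
      push_cast
      ring
    rw [norm_div, norm_pow, norm_pow, hn]
    rcases le_total (2 * y) 1 with h | h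
    · rw [abs_of_nonneg (by linarith)] at hd
      have : (y * (1 - y)) ^ l / ‖w - 1 + 2 * (y : ℂ)‖ ^ (l + 1) ≤ g y := by
        simp only [hg]
        gcongr
        linarith
      linarith
    · rw [abs_of_nonpos (by linarith)] at hd
      have : (y * (1 - y)) ^ l / ‖w - 1 + 2 * (y : ℂ)‖ ^ (l + 1) ≤ g (1 - y) := by
        simp only [hg]
        rw [show (1 - y) * (1 - (1 - y)) = y * (1 - y) by ring]
        gcongr
        linarith
      linarith
  rw [intervalIntegral.integral_add hi hi', hsymm] at hb
  have h2 : ‖(2 : ℂ) ^ (l + 1)‖ = 2 ^ (l + 1) := by simp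
  rw [h2]
  calc _ ≤ 2 ^ (l + 1) * ((∫ y in (0 : ℝ)..1, g y) + ∫ y in (0 : ℝ)..1, g y) := by gcongr
    _ = _ := by ring

/-! ### Cauchy's formula on rectangles -/

theorem log_neg_sub_log_of_im_neg {z : ℂ} (hz : z.im < 0) :
    Complex.log (-z) - Complex.log z = Real.pi * Complex.I := by
  rw [Complex.log, Complex.log, norm_neg, Complex.arg_neg_eq_arg_add_pi_of_im_neg hz]
  push_cast
  ring

theorem log_neg_sub_log_of_im_pos {z : ℂ} (hz : 0 < z.im) :
    Complex.log (-z) - Complex.log z = -(Real.pi * Complex.I) := by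
  rw [Complex.log, Complex.log, norm_neg, Complex.arg_neg_eq_arg_sub_pi_of_im_pos hz]
  push_cast
  ring

theorem integral_inv_affine {a b : ℝ} {m d : ℂ} (hm : m ≠ 0)
    (h : ∀ x ∈ uIcc a b, (x : ℂ) * m + d ∈ Complex.slitPlane) :
    ∫ x in a..b, ((x : ℂ) * m + d)⁻¹ =
      m⁻¹ * (Complex.log (b * m + d) - Complex.log (a * m + d)) := by
  have hd : ∀ x ∈ uIcc a b, HasDerivAt (fun x : ℝ => m⁻¹ * Complex.log ((x : ℂ) * m + d))
      ((x : ℂ) * m + d)⁻¹ x := by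
    intro x hx
    have e1 : HasDerivAt (fun z : ℂ => z * m + d) m (x : ℂ) := by
      simpa using ((hasDerivAt_id (x : ℂ)).mul_const m).add_const d
    refine ((e1.clog (h x hx)).const_mul m⁻¹).comp_ofReal.congr_deriv ?_
    field_simp
  rw [intervalIntegral.integral_eq_sub_of_hasDerivAt hd, mul_sub]
  refine ContinuousOn.intervalIntegrable (ContinuousOn.inv₀ (by fun_prop) fun x hx => ?_)
  exact Complex.slitPlane_ne_zero (h x hx)

/-- The winding number of the boundary of a rectangle around an interior point, computed with the
principal logarithm on three sides and with `log (-z)` on the left side, which crosses its cut. -/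
theorem integral_boundary_rect_inv {x₁ x₂ y₁ y₂ : ℝ} {w : ℂ} (h1 : x₁ < w.re) (h2 : w.re < x₂)
    (h3 : y₁ < w.im) (h4 : w.im < y₂) :
    (∫ x : ℝ in x₁..x₂, ((x : ℂ) + y₁ * Complex.I - w)⁻¹) -
      (∫ x : ℝ in x₁..x₂, ((x : ℂ) + y₂ * Complex.I - w)⁻¹) +
      Complex.I * (∫ y : ℝ in y₁..y₂, ((x₂ : ℂ) + y * Complex.I - w)⁻¹) -
      Complex.I * (∫ y : ℝ in y₁..y₂, ((x₁ : ℂ) + y * Complex.I - w)⁻¹) =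
      2 * Real.pi * Complex.I := by
  have sB : ∀ x : ℝ, ((x : ℂ) + y₁ * Complex.I - w).im < 0 := by
    intro x; simp; linarith
  have sT : ∀ x : ℝ, 0 < ((x : ℂ) + y₂ * Complex.I - w).im := by
    intro x; simp; linarith
  have sR : ∀ y : ℝ, 0 < ((x₂ : ℂ) + y * Complex.I - w).re := by
    intro x; simp; linarith
  have sL : ∀ y : ℝ, 0 < (-((x₁ : ℂ) + y * Complex.I - w)).re := by
    intro x; simp; linarith
  have e1 : ∀ (x y : ℝ), (x : ℂ) + y * Complex.I - w = x * 1 + (y * Complex.I - w) := by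
    intros; ring
  have e2 : ∀ (x y : ℝ), (x : ℂ) + y * Complex.I - w = y * Complex.I + (x - w) := by
    intros; ring
  have e3 : ∀ (x y : ℝ), ((x : ℂ) + y * Complex.I - w)⁻¹ =
      -((y * (-Complex.I) + (-x + w) : ℂ))⁻¹ := by
    intros; rw [← inv_neg]; congr 1; ring
  have e3' : ∀ (x y : ℝ), (y * (-Complex.I) + (-x + w) : ℂ) =
      -((x : ℂ) + y * Complex.I - w) := by
    intros; ring
  have iB : (∫ x : ℝ in x₁..x₂, ((x : ℂ) + y₁ * Complex.I - w)⁻¹) =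
      Complex.log (x₂ + y₁ * Complex.I - w) - Complex.log (x₁ + y₁ * Complex.I - w) := by
    simp only [e1]
    rw [integral_inv_affine one_ne_zero, inv_one, one_mul]
    intro x _
    rw [← e1]
    exact Or.inr (sB x).ne
  have iT : (∫ x : ℝ in x₁..x₂, ((x : ℂ) + y₂ * Complex.I - w)⁻¹) =
      Complex.log (x₂ + y₂ * Complex.I - w) - Complex.log (x₁ + y₂ * Complex.I - w) := by
    simp only [e1]
    rw [integral_inv_affine one_ne_zero, inv_one, one_mul]
    intro x _
    rw [← e1]
    exact Or.inr (sT x).ne'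
  have iR : Complex.I * (∫ y : ℝ in y₁..y₂, ((x₂ : ℂ) + y * Complex.I - w)⁻¹) =
      Complex.log (x₂ + y₂ * Complex.I - w) - Complex.log (x₂ + y₁ * Complex.I - w) := by
    simp only [e2]
    rw [integral_inv_affine Complex.I_ne_zero, ← mul_assoc, mul_inv_cancel₀ Complex.I_ne_zero,
      one_mul]
    intro x _
    rw [← e2]
    exact Or.inl (sR x)
  have iL : Complex.I * (∫ y : ℝ in y₁..y₂, ((x₁ : ℂ) + y * Complex.I - w)⁻¹) =
      Complex.log (-(x₁ + y₂ * Complex.I - w)) - Complex.log (-(x₁ + y₁ * Complex.I - w)) := by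
    simp only [e3, intervalIntegral.integral_neg]
    rw [integral_inv_affine (neg_ne_zero.2 Complex.I_ne_zero), e3', e3', inv_neg, neg_mul, neg_neg,
      ← mul_assoc, mul_inv_cancel₀ Complex.I_ne_zero, one_mul]
    intro x _
    rw [e3']
    exact Or.inl (sL x)
  rw [iB, iT, iR, iL]
  linear_combination log_neg_sub_log_of_im_neg (sB x₁) - log_neg_sub_log_of_im_pos (sT x₁)

/-- The Cauchy kernel `1/(w - x) + 1/(w + x)`, odd in `w` and even in `x`: it reproduces a function
whose continuation across the real axis is `z ↦ a (-z)` from the upper half of the contour. -/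
noncomputable def pairKernel (w x : ℂ) : ℂ := (w - x)⁻¹ + (w + x)⁻¹

theorem pairKernel_neg (w x : ℂ) : pairKernel (-w) x = -pairKernel w x := by
  rw [pairKernel, pairKernel, show -w - x = -(w + x) by ring, show -w + x = -(w - x) by ring,
    inv_neg, inv_neg]
  ring

/-- Cauchy's formula on the upper half of the square `[-X, X] × [-X, X]`, the pole at `-w` of the
kernel lying in the lower half. -/
theorem integral_boundary_rect_pairKernel {a : ℂ → ℂ} {X : ℝ}
    (hc : ContinuousOn a (Icc (-X) X ×ℂ Icc 0 X))
    (hd : DifferentiableOn ℂ a (Ioo (-X) X ×ℂ Ioo 0 X)) {w : ℂ} (hw : w ∈ Ioo (-X) X ×ℂ Ioo 0 X) :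
    (∫ x : ℝ in (-X)..X, a x * pairKernel x w) -
      (∫ x : ℝ in (-X)..X, a (x + X * Complex.I) * pairKernel (x + X * Complex.I) w) +
      Complex.I * (∫ y : ℝ in 0..X, a (X + y * Complex.I) * pairKernel (X + y * Complex.I) w) -
      Complex.I * (∫ y : ℝ in 0..X, a (-X + y * Complex.I) * pairKernel (-X + y * Complex.I) w) =
      2 * Real.pi * Complex.I * a w := by
  obtain ⟨⟨hw1, hw2⟩, hw3, hw4⟩ := hw
  have hX : 0 < X := hw3.trans hw4
  have hwo : (Ioo (-X) X ×ℂ Ioo 0 X) ∈ 𝓝 w :=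
    (isOpen_Ioo.reProdIm isOpen_Ioo).mem_nhds ⟨⟨hw1, hw2⟩, hw3, hw4⟩
  have hsub : (Ioo (-X) X ×ℂ Ioo 0 X) ⊆ (Icc (-X) X ×ℂ Icc 0 X) := fun z hz =>
    ⟨Ioo_subset_Icc_self hz.1, Ioo_subset_Icc_self hz.2⟩
  -- removing the singularity at `w` leaves a function to which Cauchy-Goursat applies
  set f : ℂ → ℂ := fun z => dslope a w z + a z * (z + w)⁻¹ with hf
  have hne : ∀ z ∈ Icc (-X) X ×ℂ Icc 0 X, z + w ≠ 0 := by
    intro z hz h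
    have := congrArg Complex.im h
    simp at this
    linarith [hz.2.1]
  have fc : ContinuousOn f (Icc (-X) X ×ℂ Icc 0 X) := by
    refine ContinuousOn.add ((continuousOn_dslope (mem_of_superset hwo hsub)).2
      ⟨hc, hd.differentiableAt hwo⟩) (hc.mul (ContinuousOn.inv₀ (by fun_prop) hne))
  have fd : DifferentiableOn ℂ f (Ioo (-X) X ×ℂ Ioo 0 X) := by
    refine DifferentiableOn.add ((Complex.differentiableOn_dslope hwo).2 hd)
      (hd.mul (DifferentiableOn.inv (by fun_prop) fun z hz => hne z (hsub hz)))
  have h0 := Complex.integral_boundary_rect_eq_zero_of_continuousOn_of_differentiableOn f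
    (⟨-X, 0⟩ : ℂ) ⟨X, X⟩ (by simpa [uIcc_of_le hX.le, uIcc_of_le (by linarith : -X ≤ X)] using fc)
    (by simpa [min_eq_left (by linarith : -X ≤ X), max_eq_right (by linarith : -X ≤ X),
      min_eq_left hX.le, max_eq_right hX.le] using fd)
  simp only [Complex.ofReal_zero, zero_mul, add_zero, smul_eq_mul, Complex.ofReal_neg] at h0
  have key : ∀ z : ℂ, z ≠ w → f z = a z * pairKernel z w - a w * (z - w)⁻¹ := by
    intro z hz
    simp only [hf, pairKernel, dslope_of_ne _ hz, slope_def_field]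
    ring
  have hi := integral_boundary_rect_inv hw1 hw2 hw3 hw4
  have side : ∀ (γ : ℝ → ℂ) (p q : ℝ), Continuous γ →
      (∀ y ∈ uIcc p q, γ y ∈ Icc (-X) X ×ℂ Icc 0 X ∧ γ y ≠ w) →
      ∫ y in p..q, f (γ y) =
        (∫ y in p..q, a (γ y) * pairKernel (γ y) w) - a w * ∫ y in p..q, (γ y - w)⁻¹ := by
    intro γ p q hγ h
    have hac : ContinuousOn (fun y => a (γ y)) (uIcc p q) :=
      hc.comp hγ.continuousOn fun y hy => (h y hy).1
    have k1 : ContinuousOn (fun y => (γ y - w)⁻¹) (uIcc p q) :=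
      ContinuousOn.inv₀ (by fun_prop) fun y hy => sub_ne_zero.2 (h y hy).2
    have k2 : ContinuousOn (fun y => (γ y + w)⁻¹) (uIcc p q) :=
      ContinuousOn.inv₀ (by fun_prop) fun y hy => hne _ (h y hy).1
    have hk : ContinuousOn (fun y => pairKernel (γ y) w) (uIcc p q) := k1.add k2
    have hm : IntervalIntegrable (fun y => a (γ y) * pairKernel (γ y) w) volume p q :=
      (hac.mul hk).intervalIntegrable
    rw [← intervalIntegral.integral_const_mul,
      ← intervalIntegral.integral_sub hm (k1.intervalIntegrable.const_mul _)]
    exact intervalIntegral.integral_congr fun y hy => key _ (h y hy).2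
  have hXX : uIcc (-X) X = Icc (-X) X := uIcc_of_le (by linarith)
  have h0X : uIcc 0 X = Icc 0 X := uIcc_of_le hX.le
  have sB := side (fun x => (x : ℂ)) (-X) X (by fun_prop) (by
    intro y hy
    rw [hXX] at hy
    refine ⟨⟨by simpa using hy, by simpa using hX.le⟩, fun h => ?_⟩
    have := congrArg Complex.im h
    simp at this
    linarith)
  have sT := side (fun x => (x : ℂ) + X * Complex.I) (-X) X (by fun_prop) (by
    intro y hy
    rw [hXX] at hy
    refine ⟨⟨by simpa using hy, by simpa using hX.le⟩, fun h => ?_⟩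
    have := congrArg Complex.im h
    simp at this
    linarith)
  have sR := side (fun y => (X : ℂ) + y * Complex.I) 0 X (by fun_prop) (by
    intro y hy
    rw [h0X] at hy
    refine ⟨⟨by simpa using hX.le, by simpa using hy⟩, fun h => ?_⟩
    have := congrArg Complex.re h
    simp at this
    linarith)
  have sL := side (fun y => (-X : ℂ) + y * Complex.I) 0 X (by fun_prop) (by
    intro y hy
    rw [h0X] at hy
    refine ⟨⟨by simpa using hX.le, by simpa using hy⟩, fun h => ?_⟩
    have := congrArg Complex.re h
    simp at this
    linarith)
  rw [sB, sT, sR, sL] at h0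
  simp only [Complex.ofReal_zero, zero_mul, add_zero, Complex.ofReal_neg] at hi
  linear_combination h0 + a w * hi

/-! ### Legendre coefficients of boundary values -/

theorem continuous_legendreP (l : ℕ) : Continuous fun x : ℝ => legendreP l x := by
  simp only [legendreP, Polynomial.aeval_def]
  fun_prop

theorem norm_integral_pairKernel_mul_legendreP_le (l : ℕ) {w : ℂ} (hw : 1 < ‖w‖) :
    ‖∫ x in (-1 : ℝ)..1, pairKernel w x * (legendreP l x : ℂ)‖ ≤ 8 * legendreQ l ‖w‖ := by
  have hP : Continuous fun x : ℝ => (legendreP l x : ℂ) :=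
    Complex.continuous_ofReal.comp (continuous_legendreP l)
  have hne : ∀ v : ℂ, 1 < ‖v‖ → ∀ x ∈ uIcc (-1 : ℝ) 1, v - x ≠ 0 := by
    intro v hv x hx h
    rw [uIcc_of_le (by norm_num)] at hx
    rw [sub_eq_zero.1 h, Complex.norm_real, Real.norm_eq_abs] at hv
    exact absurd (abs_le.2 hx) (not_le.2 hv)
  have hint : ∀ v : ℂ, 1 < ‖v‖ → IntervalIntegrable
      (fun x : ℝ => (legendreP l x : ℂ) / (v - x)) volume (-1) 1 := fun v hv =>
    (ContinuousOn.div hP.continuousOn (by fun_prop) (hne v hv)).intervalIntegrable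
  have hw' : 1 < ‖-w‖ := by rwa [norm_neg]
  have e : ∀ x : ℝ, pairKernel w x * (legendreP l x : ℂ) =
      (legendreP l x : ℂ) / (w - x) - (legendreP l x : ℂ) / (-w - x) := by
    intro x
    rw [pairKernel, show -w - (x : ℂ) = -(w + x) by ring, div_neg, div_eq_mul_inv, div_eq_mul_inv]
    ring
  simp only [e]
  rw [intervalIntegral.integral_sub (hint w hw) (hint (-w) hw')]
  have h1 := norm_integral_legendreP_div_sub_le l w hw
  have h2 := norm_integral_legendreP_div_sub_le l (-w) hw'
  rw [norm_neg] at h2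
  exact (norm_sub_le _ _).trans (by linarith)

section path

variable {γ g : ℝ → ℂ} {b c r : ℝ}

theorem tendsto_integral_mul_pairKernel (hr : 1 < r) (hγ : Continuous γ)
    (hg : ContinuousOn g (uIcc b c)) (hγr : ∀ y ∈ uIcc b c, r ≤ ‖γ y‖) {x : ℝ} (hx : |x| ≤ 1) :
    Tendsto (fun δ : ℝ => ∫ y in b..c, g y * pairKernel (γ y) (x + δ * Complex.I)) (𝓝[>] 0)
      (𝓝 (∫ y in b..c, g y * pairKernel (γ y) x)) := by
  set d := (r - 1) / 2 with hd
  have hd0 : 0 < d := by rw [hd]; linarith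
  have hev : ∀ᶠ δ : ℝ in 𝓝[>] 0, |δ| ≤ d := by
    have : Tendsto (fun δ : ℝ => |δ|) (𝓝[>] 0) (𝓝 0) := by
      simpa using (continuous_abs.tendsto (0 : ℝ)).mono_left nhdsWithin_le_nhds
    exact (this.eventually (gt_mem_nhds hd0)).mono fun _ h => h.le
  have hfar : ∀ δ : ℝ, |δ| ≤ d → ∀ y ∈ uIcc b c,
      d ≤ ‖γ y - (x + δ * Complex.I)‖ ∧ d ≤ ‖γ y + (x + δ * Complex.I)‖ := by
    intro δ hδ y hy
    have h1 : ‖(x : ℂ) + δ * Complex.I‖ ≤ 1 + d := by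
      refine (norm_add_le _ _).trans ?_
      simp only [norm_mul, Complex.norm_real, Complex.norm_I, mul_one, Real.norm_eq_abs]
      linarith
    have h2 := norm_sub_norm_le (γ y) (x + δ * Complex.I)
    have h3 := norm_sub_norm_le (γ y) (-(x + δ * Complex.I))
    rw [norm_neg, sub_neg_eq_add] at h3
    have h4 := hγr y hy
    constructor <;> linarith
  have hcont : ∀ δ : ℝ, |δ| ≤ d →
      ContinuousOn (fun y => g y * pairKernel (γ y) (x + δ * Complex.I)) (uIcc b c) := by
    intro δ hδ
    refine hg.mul (ContinuousOn.add ?_ ?_)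
    · exact ContinuousOn.inv₀ (by fun_prop) fun y hy =>
        norm_pos_iff.1 (hd0.trans_le (hfar δ hδ y hy).1)
    · exact ContinuousOn.inv₀ (by fun_prop) fun y hy =>
        norm_pos_iff.1 (hd0.trans_le (hfar δ hδ y hy).2)
  refine intervalIntegral.tendsto_integral_filter_of_dominated_convergence
    (fun y => ‖g y‖ * (d⁻¹ + d⁻¹)) ?_ ?_ ?_ ?_
  · filter_upwards [hev] with δ hδ
    exact ((hcont δ hδ).mono uIoc_subset_uIcc).aestronglyMeasurable measurableSet_uIoc
  · filter_upwards [hev] with δ hδ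
    refine ae_of_all _ fun y hy => ?_
    obtain ⟨h1, h2⟩ := hfar δ hδ y (uIoc_subset_uIcc hy)
    rw [norm_mul, pairKernel]
    refine mul_le_mul_of_nonneg_left ((norm_add_le _ _).trans ?_) (norm_nonneg _)
    rw [norm_inv, norm_inv]
    gcongr
  · exact (hg.norm.mul continuousOn_const).intervalIntegrable
  · refine ae_of_all _ fun y hy => ?_
    obtain ⟨h1, h2⟩ := hfar 0 (by simpa using hd0.le) y (uIoc_subset_uIcc hy)
    have hx0 : Tendsto (fun δ : ℝ => (x : ℂ) + δ * Complex.I) (𝓝[>] 0) (𝓝 x) := by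
      have : Continuous fun δ : ℝ => (x : ℂ) + δ * Complex.I := by fun_prop
      simpa using (this.tendsto 0).mono_left nhdsWithin_le_nhds
    simp only [Complex.ofReal_zero, zero_mul, add_zero] at h1 h2
    refine Tendsto.const_mul _ (Tendsto.add ?_ ?_)
    · exact (hx0.const_sub _).inv₀ (norm_pos_iff.1 (hd0.trans_le h1))
    · exact (hx0.const_add _).inv₀ (norm_pos_iff.1 (hd0.trans_le h2))

/-- Fubini turns the projection of a Cauchy integral on `P_l` into an integral against the
Neumann integral of `P_l`, hence against `Q_l`. -/
theorem norm_integral_integral_pairKernel_le (l : ℕ) (hbc : b ≤ c) (hγ : Continuous γ)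
    (hg : ContinuousOn g (uIcc b c)) (hγr : ∀ y ∈ uIcc b c, 1 < ‖γ y‖) {h : ℝ → ℝ}
    (hh : IntervalIntegrable h volume b c)
    (hgh : ∀ y ∈ Ioc b c, ‖g y‖ * legendreQ l ‖γ y‖ ≤ h y) :
    IntervalIntegrable
      (fun x : ℝ => (∫ y in b..c, g y * pairKernel (γ y) x) * (legendreP l x : ℂ)) volume (-1) 1 ∧
    ‖∫ x in (-1 : ℝ)..1, (∫ y in b..c, g y * pairKernel (γ y) x) * (legendreP l x : ℂ)‖ ≤
      8 * ∫ y in b..c, h y := by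
  have hP : Continuous fun x : ℝ => (legendreP l x : ℂ) :=
    Complex.continuous_ofReal.comp (continuous_legendreP l)
  have hne : ∀ x ∈ uIcc (-1 : ℝ) 1, ∀ y ∈ uIcc b c, γ y - x ≠ 0 ∧ γ y + x ≠ 0 := by
    intro x hx y hy
    rw [uIcc_of_le (by norm_num)] at hx
    have h1 := hγr y hy
    have h2 : ‖(x : ℂ)‖ ≤ 1 := by
      rw [Complex.norm_real, Real.norm_eq_abs]; exact abs_le.2 hx
    constructor <;> intro h
    · rw [sub_eq_zero.1 h] at h1
      exact absurd h2 (not_le.2 h1)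
    · rw [eq_neg_of_add_eq_zero_left h, norm_neg] at h1
      exact absurd h2 (not_le.2 h1)
  have hK : ContinuousOn (fun p : ℝ × ℝ => g p.2 * pairKernel (γ p.2) p.1 * (legendreP l p.1 : ℂ))
      (uIcc (-1) 1 ×ˢ uIcc b c) := by
    refine ContinuousOn.mul (ContinuousOn.mul (hg.comp continuousOn_snd fun p hp => hp.2)
      (ContinuousOn.add ?_ ?_)) (hP.comp continuous_fst).continuousOn
    · exact ContinuousOn.inv₀ (by fun_prop) fun p hp => (hne _ hp.1 _ hp.2).1
    · exact ContinuousOn.inv₀ (by fun_prop) fun p hp => (hne _ hp.1 _ hp.2).2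
  have hI : IntegrableOn (Function.uncurry fun x y : ℝ =>
      g y * pairKernel (γ y) x * (legendreP l x : ℂ)) (uIoc (-1) 1 ×ˢ uIoc b c) :=
    (hK.integrableOn_compact (isCompact_uIcc.prod isCompact_uIcc)).mono_set
      (prod_mono uIoc_subset_uIcc uIoc_subset_uIcc)
  simp only [← intervalIntegral.integral_mul_const]
  constructor
  · have h1 : Integrable (Function.uncurry fun x y : ℝ =>
        g y * pairKernel (γ y) x * (legendreP l x : ℂ))
        ((volume.restrict (uIoc (-1) 1)).prod (volume.restrict (uIoc b c))) := by
      rw [Measure.prod_restrict, ← Measure.volume_eq_prod]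
      exact hI
    rw [intervalIntegrable_iff]
    refine h1.integral_prod_left.congr (ae_of_all _ fun x => ?_)
    simp only [intervalIntegral.integral_of_le hbc, uIoc_of_le hbc, Function.uncurry]
  rw [MeasureTheory.intervalIntegral_intervalIntegral_swap hI,
    ← intervalIntegral.integral_const_mul]
  refine intervalIntegral.norm_integral_le_of_norm_le hbc (ae_of_all _ fun y hy => ?_)
    (hh.const_mul 8)
  have hy' : y ∈ uIcc b c := by rw [uIcc_of_le hbc]; exact Ioc_subset_Icc_self hy
  simp only [mul_assoc]
  rw [intervalIntegral.integral_const_mul, norm_mul]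
  have h1 := mul_le_mul_of_nonneg_left
    (norm_integral_pairKernel_mul_legendreP_le l (hγr y hy')) (norm_nonneg (g y))
  linarith [hgh y hy]

end path

/-- The kernel is odd in `x`, so on the real side only the jump `a x - a (-x)` matters, and that
vanishes on `[0, x₁]`. -/
theorem integral_mul_pairKernel_eq_integral_jump {a : ℂ → ℂ} {X x₁ : ℝ} (hx₁ : 0 ≤ x₁) (hX : x₁ ≤ X)
    (hc : ContinuousOn (fun x : ℝ => a x) (Icc (-X) X))
    (heven : ∀ x : ℝ, 0 ≤ x → x ≤ x₁ → a x = a (-x)) {w : ℂ} (hw : 0 < w.im) :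
    ∫ x : ℝ in (-X)..X, a x * pairKernel x w =
      ∫ x : ℝ in x₁..X, (a x - a (-x)) * pairKernel x w := by
  have hk : Continuous fun x : ℝ => pairKernel x w := by
    refine Continuous.add ?_ ?_
    · refine Continuous.inv₀ (by fun_prop) fun x h => ?_
      have := congrArg Complex.im h
      simp at this
      linarith
    · refine Continuous.inv₀ (by fun_prop) fun x h => ?_
      have := congrArg Complex.im h
      simp at this
      linarith
  have hX0 : 0 ≤ X := hx₁.trans hX
  have hi : ∀ p q : ℝ, p ∈ Icc (-X) X → q ∈ Icc (-X) X →
      IntervalIntegrable (fun x : ℝ => a x * pairKernel x w) volume p q := fun p q hp hq =>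
    ((hc.mono (uIcc_subset_Icc hp hq)).mul hk.continuousOn).intervalIntegrable
  have hi0 := hi 0 X ⟨by linarith, hX0⟩ ⟨by linarith, le_rfl⟩
  have hin := hi (-X) 0 ⟨le_rfl, by linarith⟩ ⟨by linarith, hX0⟩
  have hneg : ∫ x : ℝ in (-X)..0, a x * pairKernel x w =
      ∫ x : ℝ in (0 : ℝ)..X, -(a (-x) * pairKernel x w) := by
    have := intervalIntegral.integral_comp_neg (a := 0) (b := X)
      (fun x : ℝ => a x * pairKernel x w)
    rw [neg_zero] at this
    rw [← this]
    refine intervalIntegral.integral_congr fun x _ => ?_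
    simp only [Complex.ofReal_neg, pairKernel_neg]
    ring
  have hin' : IntervalIntegrable (fun x : ℝ => -(a (-x) * pairKernel x w)) volume 0 X := by
    have := (hin.comp_sub_left 0).symm
    simpa only [zero_sub, sub_zero, neg_neg, Complex.ofReal_neg, pairKernel_neg, mul_neg] using this
  have hsum : ∀ x : ℝ, a x * pairKernel x w + -(a (-x) * pairKernel x w) =
      (a x - a (-x)) * pairKernel x w := fun x => by ring
  have hJ : IntervalIntegrable (fun x : ℝ => (a x - a (-x)) * pairKernel x w) volume 0 X := by
    simpa only [hsum] using hi0.add hin'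
  rw [← intervalIntegral.integral_add_adjacent_intervals hin hi0, hneg, add_comm,
    ← intervalIntegral.integral_add hi0 hin']
  simp only [hsum]
  have hx1 : x₁ ∈ uIcc 0 X := by rw [uIcc_of_le hX0]; exact ⟨hx₁, hX⟩
  rw [← intervalIntegral.integral_add_adjacent_intervals
    (hJ.mono_set (uIcc_subset_uIcc_left hx1)) (hJ.mono_set (uIcc_subset_uIcc_right hx1))]
  rw [add_eq_right]
  refine (intervalIntegral.integral_congr (g := fun _ => (0 : ℂ)) fun x hx => ?_).trans (by simp)
  rw [uIcc_of_le hx₁] at hx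
  simp [heven x hx.1 hx.2]

/-- Estimate of the Legendre coefficients of a function that is the boundary value of a
function `a` on the upper half of a square, and whose continuation to the lower half is
`z ↦ a (-z)`. By Cauchy's formula it is a Cauchy integral over the boundary of the square and over
the jump `a x - a (-x)`, and both contributions are controlled by `Q_l`. -/
theorem norm_integral_mul_legendreP_le {a : ℂ → ℂ} {X x₁ K : ℝ} (l : ℕ) (hx₁ : 1 < x₁) (hX : x₁ ≤ X)
    (hc : ContinuousOn a (Icc (-X) X ×ℂ Icc 0 X))
    (hd : DifferentiableOn ℂ a (Ioo (-X) X ×ℂ Ioo 0 X))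
    (heven : ∀ x : ℝ, 0 ≤ x → x ≤ x₁ → a x = a (-x)) (hK : 0 ≤ K)
    (hbd : ∀ z ∈ Icc (-X) X ×ℂ Icc 0 X, 0 < z.im → ‖a z‖ ≤ K) {j : ℝ → ℝ}
    (hj : IntervalIntegrable j volume x₁ X)
    (hjump : ∀ x ∈ Ioc x₁ X, ‖a x - a (-x)‖ * legendreQ l x ≤ j x) :
    ‖∫ x : ℝ in (-1 : ℝ)..1, a x * (legendreP l x : ℂ)‖ ≤
      32 * (X * K * legendreQ l X) + 8 * ∫ x in x₁..X, j x := by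
  have hX1 : 1 < X := hx₁.trans_le hX
  have hX0 : 0 < X := one_pos.trans hX1
  have hXX : uIcc (-X) X = Icc (-X) X := uIcc_of_le (by linarith)
  have h0X : uIcc 0 X = Icc 0 X := uIcc_of_le hX0.le
  have h1X : uIcc x₁ X = Icc x₁ X := uIcc_of_le hX
  have hmR : ∀ x ∈ Icc (-X) X, (x : ℂ) ∈ Icc (-X) X ×ℂ Icc 0 X := fun x hx =>
    ⟨by simpa using hx, by simpa using hX0.le⟩
  have hmT : ∀ x ∈ Icc (-X) X, (x : ℂ) + X * Complex.I ∈ Icc (-X) X ×ℂ Icc 0 X := fun x hx =>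
    ⟨by simpa using hx, by simpa using hX0.le⟩
  have hmE : ∀ y ∈ Icc 0 X, (X : ℂ) + y * Complex.I ∈ Icc (-X) X ×ℂ Icc 0 X := fun x hx =>
    ⟨by simpa using hX0.le, by simpa using hx⟩
  have hmW : ∀ y ∈ Icc 0 X, (-X : ℂ) + y * Complex.I ∈ Icc (-X) X ×ℂ Icc 0 X := fun x hx =>
    ⟨by simpa using hX0.le, by simpa using hx⟩
  have cT : ContinuousOn (fun x : ℝ => a (x + X * Complex.I)) (uIcc (-X) X) := by
    rw [hXX]; exact hc.comp (by fun_prop) hmT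
  have cE : ContinuousOn (fun y : ℝ => a (X + y * Complex.I)) (uIcc 0 X) := by
    rw [h0X]; exact hc.comp (by fun_prop) hmE
  have cW : ContinuousOn (fun y : ℝ => a (-X + y * Complex.I)) (uIcc 0 X) := by
    rw [h0X]; exact hc.comp (by fun_prop) hmW
  have cR : ContinuousOn (fun x : ℝ => a x) (Icc (-X) X) := hc.comp (by fun_prop) hmR
  have cJ : ContinuousOn (fun x : ℝ => a x - a (-x)) (uIcc x₁ X) := by
    rw [h1X]
    refine (cR.mono (Icc_subset_Icc (by linarith) le_rfl)).sub ?_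
    refine hc.comp (f := fun x : ℝ => -(x : ℂ)) (by fun_prop) fun x hx => ?_
    have := hmR (-x) ⟨by linarith [hx.2], by linarith [hx.1]⟩
    simpa using this
  -- lower bounds for the modulus along the four pieces of the contour
  have nT : ∀ x : ℝ, X ≤ ‖(x : ℂ) + X * Complex.I‖ := fun x => by
    have := Complex.abs_im_le_norm ((x : ℂ) + X * Complex.I)
    simp at this
    exact (le_abs_self X).trans this
  have nE : ∀ y : ℝ, X ≤ ‖(X : ℂ) + y * Complex.I‖ := fun x => by
    have := Complex.abs_re_le_norm ((X : ℂ) + x * Complex.I)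
    simp at this
    exact (le_abs_self X).trans this
  have nW : ∀ y : ℝ, X ≤ ‖(-X : ℂ) + y * Complex.I‖ := fun x => by
    have := Complex.abs_re_le_norm ((-X : ℂ) + x * Complex.I)
    simp at this
    exact (le_abs_self X).trans this
  have nJ : ∀ x ∈ uIcc x₁ X, x₁ ≤ ‖(x : ℂ)‖ := fun x hx => by
    rw [h1X] at hx
    rw [Complex.norm_real]
    exact hx.1.trans (le_abs_self x)
  set T : ℝ → ℂ := fun x => ∫ y : ℝ in (-X)..X,
    a (y + X * Complex.I) * pairKernel (y + X * Complex.I) x with hT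
  set E : ℝ → ℂ := fun x => ∫ y : ℝ in (0)..X,
    a (X + y * Complex.I) * pairKernel (X + y * Complex.I) x with hE
  set W : ℝ → ℂ := fun x => ∫ y : ℝ in (0)..X,
    a (-X + y * Complex.I) * pairKernel (-X + y * Complex.I) x with hW
  set J : ℝ → ℂ := fun x => ∫ y : ℝ in x₁..X, (a y - a (-y)) * pairKernel y x with hJ
  -- Cauchy's formula at the boundary points `x ∈ [-1, 1]`
  have hrep : ∀ x ∈ Icc (-1 : ℝ) 1,
      J x - T x + Complex.I * E x - Complex.I * W x = 2 * Real.pi * Complex.I * a x := by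
    intro x hx
    have hx' : |x| ≤ 1 := abs_le.2 hx
    have tT := tendsto_integral_mul_pairKernel hX1
      (γ := fun y : ℝ => (y : ℂ) + X * Complex.I) (by fun_prop) cT (fun y _ => nT y) hx'
    have tE := tendsto_integral_mul_pairKernel hX1
      (γ := fun y : ℝ => (X : ℂ) + y * Complex.I) (by fun_prop) cE (fun y _ => nE y) hx'
    have tW := tendsto_integral_mul_pairKernel hX1
      (γ := fun y : ℝ => (-X : ℂ) + y * Complex.I) (by fun_prop) cW (fun y _ => nW y) hx'
    have tJ := tendsto_integral_mul_pairKernel hx₁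
      (γ := fun y : ℝ => (y : ℂ)) (by fun_prop) cJ nJ hx'
    have hev : ∀ᶠ δ : ℝ in 𝓝[>] 0, 0 < δ ∧ δ < X :=
      (eventually_mem_nhdsWithin).and (mem_nhdsWithin_of_mem_nhds (Iio_mem_nhds hX0))
    have hδ : Tendsto (fun δ : ℝ => (x : ℂ) + δ * Complex.I) (𝓝[>] 0)
        (𝓝[Icc (-X) X ×ℂ Icc 0 X] x) := by
      refine tendsto_nhdsWithin_iff.2 ⟨?_, ?_⟩
      · have : Continuous fun δ : ℝ => (x : ℂ) + δ * Complex.I := by fun_prop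
        simpa using (this.tendsto 0).mono_left nhdsWithin_le_nhds
      · filter_upwards [hev] with δ hδ
        refine ⟨?_, ?_⟩
        · simpa using ⟨by linarith [hx.1], by linarith [hx.2]⟩
        · simpa using ⟨hδ.1.le, hδ.2.le⟩
    have ta : Tendsto (fun δ : ℝ => 2 * Real.pi * Complex.I * a (x + δ * Complex.I)) (𝓝[>] 0)
        (𝓝 (2 * Real.pi * Complex.I * a x)) :=
      Tendsto.const_mul _ ((hc _ (hmR x ⟨by linarith [hx.1], by linarith [hx.2]⟩)).tendsto.comp hδ)
    refine tendsto_nhds_unique (((tJ.sub tT).add (tE.const_mul Complex.I)).sub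
      (tW.const_mul Complex.I)) (ta.congr' ?_)
    filter_upwards [hev] with δ hδ
    have hmem : (x : ℂ) + δ * Complex.I ∈ Ioo (-X) X ×ℂ Ioo 0 X := by
      refine ⟨?_, ?_⟩
      · simpa using ⟨by linarith [hx.1], by linarith [hx.2]⟩
      · simpa using hδ
    rw [← integral_boundary_rect_pairKernel hc hd hmem,
      integral_mul_pairKernel_eq_integral_jump (by linarith) hX cR heven (by simpa using hδ.1)]
  have hP : Continuous fun x : ℝ => (legendreP l x : ℂ) :=
    Complex.continuous_ofReal.comp (continuous_legendreP l)
  have hQ : 0 ≤ legendreQ l X := legendreQ_nonneg l hX1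
  have hside : ∀ w : ℂ, X ≤ ‖w‖ → w ∈ Icc (-X) X ×ℂ Icc 0 X → 0 < w.im →
      ‖a w‖ * legendreQ l ‖w‖ ≤ K * legendreQ l X := fun w h1 h2 h3 =>
    mul_le_mul (hbd w h2 h3) (legendreQ_anti l hX1 h1) (legendreQ_nonneg l (hX1.trans_le h1)) hK
  have bT := norm_integral_integral_pairKernel_le l (by linarith : -X ≤ X)
    (γ := fun y : ℝ => (y : ℂ) + X * Complex.I) (h := fun _ => K * legendreQ l X) (by fun_prop) cT
    (fun y _ => hX1.trans_le (nT y)) intervalIntegrable_const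
    (fun y hy => hside _ (nT y) (hmT y (Ioc_subset_Icc_self hy)) (by simpa using hX0))
  have bE := norm_integral_integral_pairKernel_le l hX0.le
    (γ := fun y : ℝ => (X : ℂ) + y * Complex.I) (h := fun _ => K * legendreQ l X) (by fun_prop) cE
    (fun y _ => hX1.trans_le (nE y)) intervalIntegrable_const
    (fun y hy => hside _ (nE y) (hmE y (Ioc_subset_Icc_self hy)) (by simpa using hy.1))
  have bW := norm_integral_integral_pairKernel_le l hX0.le
    (γ := fun y : ℝ => (-X : ℂ) + y * Complex.I) (h := fun _ => K * legendreQ l X) (by fun_prop) cW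
    (fun y _ => hX1.trans_le (nW y)) intervalIntegrable_const
    (fun y hy => hside _ (nW y) (hmW y (Ioc_subset_Icc_self hy)) (by simpa using hy.1))
  have bJ := norm_integral_integral_pairKernel_le l hX
    (γ := fun y : ℝ => (y : ℂ)) (h := j) (by fun_prop) cJ
    (fun y hy => hx₁.trans_le (nJ y hy)) hj (fun y hy => by
      have hy0 : 0 ≤ y := by linarith [hy.1]
      simpa only [Complex.norm_real, Real.norm_of_nonneg hy0] using hjump y hy)
  obtain ⟨iT, bT⟩ := bT
  obtain ⟨iE, bE⟩ := bE
  obtain ⟨iW, bW⟩ := bW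
  obtain ⟨iJ, bJ⟩ := bJ
  simp only [intervalIntegral.integral_const, smul_eq_mul, sub_neg_eq_add, sub_zero] at bT bE bW
  have hsum : 2 * Real.pi * Complex.I * ∫ x : ℝ in (-1 : ℝ)..1, a x * (legendreP l x : ℂ) =
      (∫ x : ℝ in (-1 : ℝ)..1, J x * (legendreP l x : ℂ)) -
      (∫ x : ℝ in (-1 : ℝ)..1, T x * (legendreP l x : ℂ)) +
      Complex.I * (∫ x : ℝ in (-1 : ℝ)..1, E x * (legendreP l x : ℂ)) -
      Complex.I * (∫ x : ℝ in (-1 : ℝ)..1, W x * (legendreP l x : ℂ)) := by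
    rw [← intervalIntegral.integral_const_mul, ← intervalIntegral.integral_const_mul,
      ← intervalIntegral.integral_const_mul, ← intervalIntegral.integral_sub iJ iT,
      ← intervalIntegral.integral_add (iJ.sub iT) (iE.const_mul _),
      ← intervalIntegral.integral_sub ((iJ.sub iT).add (iE.const_mul _)) (iW.const_mul _)]
    refine intervalIntegral.integral_congr fun x hx => ?_
    rw [uIcc_of_le (by norm_num)] at hx
    linear_combination -(legendreP l x : ℂ) * hrep x hx
  have hn := congrArg norm hsum
  have h2pi : ‖(2 * Real.pi * Complex.I : ℂ)‖ = 2 * Real.pi := by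
    simp [abs_of_pos Real.pi_pos]
  have htri : ∀ p q r t : ℂ, ‖p - q + Complex.I * r - Complex.I * t‖ ≤ ‖p‖ + ‖q‖ + ‖r‖ + ‖t‖ := by
    intro p q r t
    have h1 := norm_sub_le (p - q + Complex.I * r) (Complex.I * t)
    have h2 := norm_add_le (p - q) (Complex.I * r)
    have h3 := norm_sub_le p q
    simp only [norm_mul, Complex.norm_I, one_mul] at h1 h2
    linarith
  rw [norm_mul, h2pi] at hn
  have hle : ‖∫ x : ℝ in (-1 : ℝ)..1, a x * (legendreP l x : ℂ)‖ ≤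
      2 * Real.pi * ‖∫ x : ℝ in (-1 : ℝ)..1, a x * (legendreP l x : ℂ)‖ :=
    le_mul_of_one_le_left (norm_nonneg _) (by linarith [Real.two_le_pi])
  have hfin := hle.trans (hn.le.trans (htri _ _ _ _))
  calc _ ≤ _ := hfin
    _ ≤ 8 * (∫ x in x₁..X, j x) + 8 * ((X + X) * (K * legendreQ l X)) +
        8 * (X * (K * legendreQ l X)) + 8 * (X * (K * legendreQ l X)) := by gcongr
    _ = _ := by ring

/-! ### Cut domains, tubes and boundary values -/

theorem notMem_cut_of_im_ne_zero {c : ℝ} {z : ℂ} (h : z.im ≠ 0) : z ∉ cut c := fun hz => h hz.1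

theorem notMem_cut_of_re_lt {c : ℝ} {z : ℂ} (h : z.re < c) : z ∉ cut c :=
  fun hz => absurd hz.2 (not_le.2 h)

theorem isClosed_cut (c : ℝ) : IsClosed (cut c) :=
  (isClosed_eq Complex.continuous_im continuous_const).inter
    (isClosed_le continuous_const Complex.continuous_re)

theorem isOpen_cutDomain (a b c : ℝ) : IsOpen (cutDomain a b c) := by
  refine ((isClosed_cut a).isOpen_compl.preimage continuous_fst).inter
    (((isClosed_cut b).isOpen_compl.preimage continuous_snd).inter
      ((isClosed_cut c).isOpen_compl.preimage (f := fun p : ℂ × ℂ => 4 - p.1 - p.2) ?_))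
  fun_prop

theorem continuousAt_of_mem_cutDomain {F : ℂ → ℂ → ℂ} {a b c : ℝ} {p : ℂ × ℂ}
    (h : DifferentiableOn ℂ (fun p : ℂ × ℂ => F p.1 p.2) (cutDomain a b c))
    (hp : p ∈ cutDomain a b c) : ContinuousAt (fun p : ℂ × ℂ => F p.1 p.2) p :=
  h.continuousOn.continuousAt ((isOpen_cutDomain a b c).mem_nhds hp)

theorem tendsto_of_path {E : Type*} [TopologicalSpace E] {B : E → ℂ} {S : Set E}
    (hB : ContinuousOn B S) {π : ℝ → E} (hπ : Continuous π) (h0 : π 0 ∈ S)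
    (hS : ∀ᶠ ε in 𝓝[>] (0 : ℝ), π ε ∈ S) :
    Tendsto (fun ε => B (π ε)) (𝓝[>] 0) (𝓝 (B (π 0))) :=
  (hB _ h0).tendsto.comp
    (tendsto_nhdsWithin_iff.2 ⟨(hπ.tendsto 0).mono_left nhdsWithin_le_nhds, hS⟩)

theorem eventually_pos_lt {d : ℝ} (hd : 0 < d) : ∀ᶠ ε in 𝓝[>] (0 : ℝ), 0 < ε ∧ ε < d :=
  eventually_mem_nhdsWithin.and (mem_nhdsWithin_of_mem_nhds (Iio_mem_nhds hd))

theorem mem_closure_of_path {E : Type*} [TopologicalSpace E] {S : Set E} {π : ℝ → E}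
    (hπ : Continuous π) (hS : ∀ ε : ℝ, 0 < ε → π ε ∈ S) : π 0 ∈ closure S :=
  mem_closure_of_tendsto ((hπ.tendsto 0).mono_left nhdsWithin_le_nhds :
    Tendsto π (𝓝[>] 0) (𝓝 (π 0))) (eventually_mem_nhdsWithin.mono hS)

theorem mem_closure_tube_upper {p : ℂ × ℂ} (h1 : 0 ≤ p.1.im) (h2 : 0 ≤ p.2.im) :
    p ∈ closure (tube 1 1 (-1)) := by
  have := mem_closure_of_path (S := tube 1 1 (-1))
    (π := fun ε : ℝ => (p.1 + ε * Complex.I, p.2 + ε * Complex.I)) (by fun_prop) (by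
      intro ε hε
      simp only [tube, mem_ofPred_eq]
      simp
      refine ⟨by linarith, by linarith, by linarith⟩)
  simpa using this

theorem mem_closure_tube_middle {p : ℂ × ℂ} (h1 : 0 ≤ p.1.im) (h2 : p.2.im ≤ 0)
    (h3 : 0 ≤ p.1.im + p.2.im) : p ∈ closure (tube 1 (-1) (-1)) := by
  have := mem_closure_of_path (S := tube 1 (-1) (-1))
    (π := fun ε : ℝ => (p.1 + 2 * ε * Complex.I, p.2 - ε * Complex.I)) (by fun_prop) (by
      intro ε hε
      simp only [tube, mem_ofPred_eq]
      simp
      refine ⟨by linarith, by linarith, by linarith⟩)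
  simpa using this

theorem eq_of_mem_closure {E : Type*} [TopologicalSpace E] {B f : E → ℂ} {S : Set E}
    (hB : ∀ p ∈ S, B p = f p) (hBc : ContinuousOn B (closure S)) {p : E} (hp : p ∈ closure S)
    (hf : ContinuousAt f p) : B p = f p := by
  have := mem_closure_iff_nhdsWithin_neBot.1 hp
  have h1 : Tendsto B (𝓝[S] p) (𝓝 (B p)) := ((hBc p hp).mono subset_closure).tendsto
  have h2 : Tendsto f (𝓝[S] p) (𝓝 (f p)) := hf.tendsto.mono_left nhdsWithin_le_nhds
  exact tendsto_nhds_unique h1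
    (h2.congr' (eventually_mem_nhdsWithin.mono fun q hq => (hB q hq).symm))

theorem continuousOn_of_holder {B : ℂ × ℂ → ℂ} {S : Set (ℂ × ℂ)} {μ : ℝ} (hμ : 0 < μ)
    (h : ∀ R : ℝ, ∃ C : ℝ, ∀ p ∈ S, ∀ q ∈ S,
      ‖p‖ ≤ R → ‖q‖ ≤ R → ‖B p - B q‖ ≤ C * ‖p - q‖ ^ μ) : ContinuousOn B S := by
  intro p hp
  obtain ⟨C, hC⟩ := h (‖p‖ + 1)
  rw [ContinuousWithinAt, tendsto_iff_norm_sub_tendsto_zero]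
  have h1 : Tendsto (fun q : ℂ × ℂ => C * ‖q - p‖ ^ μ) (𝓝[S] p) (𝓝 0) := by
    have : Continuous fun q : ℂ × ℂ => C * ‖q - p‖ ^ μ :=
      continuous_const.mul ((continuous_id.sub continuous_const).norm.rpow_const
        fun _ => Or.inr hμ.le)
    have h2 := (this.tendsto p).mono_left (nhdsWithin_le_nhds (s := S))
    simpa [Real.zero_rpow hμ.ne'] using h2
  refine squeeze_zero' (Eventually.of_forall fun _ => norm_nonneg _) ?_ h1
  filter_upwards [eventually_mem_nhdsWithin, mem_nhdsWithin_of_mem_nhds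
    (Metric.ball_mem_nhds p one_pos)] with q hq hq1
  refine hC q hq p hp ?_ (by linarith)
  rw [mem_ball_iff_norm] at hq1
  linarith [norm_sub_norm_le q p]

section boundary

variable {F : ℂ → ℂ → ℂ} {μ t₁ : ℝ} {B : ℂ × ℂ → ℂ}

theorem mem_mandelstamDomain_of_im {s t : ℂ} (h1 : s.im ≠ 0) (h2 : t.im ≠ 0)
    (h3 : s.im + t.im ≠ 0) : (s, t) ∈ mandelstamDomain := by
  refine ⟨notMem_cut_of_im_ne_zero h1, notMem_cut_of_im_ne_zero h2, notMem_cut_of_im_ne_zero ?_⟩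
  simp
  intro h
  apply h3
  linarith

theorem above_eq (hF : DifferentiableOn ℂ (fun p : ℂ × ℂ => F p.1 p.2) mandelstamDomain)
    (hB : ∀ p ∈ tube 1 1 (-1), B p = F p.1 p.2)
    (hBc : ContinuousOn B (closure (tube 1 1 (-1)))) (s : ℝ) {t : ℂ} (ht : 0 ≤ t.im)
    (ht4 : t ∉ cut 4) : above F s t = B (s, t) := by
  refine Tendsto.limUnder_eq ?_
  have h := tendsto_of_path hBc (π := fun ε : ℝ => ((s : ℂ) + ε * Complex.I, t)) (by fun_prop)
    (mem_closure_tube_upper (by simp) (by simpa using ht))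
    (eventually_mem_nhdsWithin.mono fun ε hε => mem_closure_tube_upper
      (by simpa using (mem_Ioi.1 hε).le) (by simpa using ht))
  simp only [Complex.ofReal_zero, zero_mul, add_zero] at h
  refine h.congr' (eventually_mem_nhdsWithin.mono fun ε hε => ?_)
  have hε' : 0 < ε := hε
  refine eq_of_mem_closure (f := fun p : ℂ × ℂ => F p.1 p.2) hB hBc (mem_closure_tube_upper
    (by simpa using hε'.le) (by simpa using ht)) (continuousAt_of_mem_cutDomain hF ⟨?_, ht4, ?_⟩)
  · exact notMem_cut_of_im_ne_zero (by simpa using hε'.ne')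
  · refine notMem_cut_of_im_ne_zero ?_
    simp
    linarith

/-- The lower boundary value in `s` is obtained from the upper one by reflection and by the
crossing `t ↔ u`. -/
theorem below_eq (hF : IsAmplitude μ F) (hB : ∀ p ∈ tube 1 1 (-1), B p = F p.1 p.2)
    (hBc : ContinuousOn B (closure (tube 1 1 (-1)))) (s : ℝ) {t : ℂ} (ht : 0 < t.im) :
    below F s t = starRingEnd ℂ (B (s, 4 - s - starRingEnd ℂ t)) := by
  refine Tendsto.limUnder_eq ?_
  have h := tendsto_of_path hBc (π := fun ε : ℝ => ((s : ℂ) + ε * Complex.I,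
      4 - s - starRingEnd ℂ t - ε * Complex.I)) (by fun_prop)
    (mem_closure_tube_upper (by simp) (by simpa using ht.le))
    ((eventually_pos_lt ht).mono fun ε hε => mem_closure_tube_upper
      (by simpa using hε.1.le) (by simpa using hε.2.le))
  simp only [Complex.ofReal_zero, zero_mul, add_zero, sub_zero] at h
  refine ((Complex.continuous_conj.tendsto _).comp h).congr' ?_
  filter_upwards [eventually_pos_lt ht] with ε hε
  have hm : ((s : ℂ) + ε * Complex.I, starRingEnd ℂ t) ∈ mandelstamDomain := by
    apply mem_mandelstamDomain_of_im <;> simp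
    · exact hε.1.ne'
    · exact ht.ne'
    · linarith [hε.2]
  have hr := hF.real_analytic _ _ hm
  rw [Complex.conj_conj] at hr
  have e : starRingEnd ℂ ((s : ℂ) + ε * Complex.I) = s - ε * Complex.I := by
    simp [sub_eq_add_neg]
  rw [e] at hr
  rw [hr, (hF.crossing _ _ hm).2.1, Function.comp_apply, hB]
  · simp only
    congr 2
    ring
  · simp only [tube, mem_ofPred_eq]
    simp
    refine ⟨hε.1, hε.2, by linarith⟩

/-- The boundary value at `s + i0` is holomorphic in `t`, as a locally uniform limit. Here, as
throughout, `B` is the extension of `F` from `Im s, Im t > 0` to the closed tube. -/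
theorem differentiableOn_boundaryValue
    (hF : DifferentiableOn ℂ (fun p : ℂ × ℂ => F p.1 p.2) mandelstamDomain)
    (hB : ∀ p ∈ tube 1 1 (-1), B p = F p.1 p.2)
    (hBc : ContinuousOn B (closure (tube 1 1 (-1)))) (s : ℝ) :
    DifferentiableOn ℂ (fun t => B (s, t)) {t | 0 < t.im} := by
  have hopen : IsOpen {t : ℂ | 0 < t.im} := isOpen_lt continuous_const Complex.continuous_im
  have hlu : TendstoLocallyUniformlyOn (fun (ε : ℝ) t => B ((s : ℂ) + ε * Complex.I, t))
      (fun t => B (s, t)) (𝓝[>] 0) {t | 0 < t.im} := by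
    rw [Metric.tendstoLocallyUniformlyOn_iff]
    intro η hη t ht
    have hp : ((s : ℂ), t) ∈ closure (tube 1 1 (-1)) :=
      mem_closure_tube_upper (by simp) (mem_ofPred_eq ▸ ht).le
    obtain ⟨δ, hδ, h⟩ := Metric.continuousOn_iff.1 hBc _ hp (η / 2) (half_pos hη)
    refine ⟨{t | 0 < t.im} ∩ Metric.ball t δ, inter_mem_nhdsWithin _ (Metric.ball_mem_nhds t hδ),
      ?_⟩
    filter_upwards [eventually_pos_lt hδ] with ε hε t' ht'
    have h1 := h ((s : ℂ), t') (mem_closure_tube_upper (by simp) (mem_ofPred_eq ▸ ht'.1).le) (by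
      rw [Prod.dist_eq]; simpa [hδ] using ht'.2)
    have h2 := h ((s : ℂ) + ε * Complex.I, t') (mem_closure_tube_upper (by simpa using hε.1.le)
      (mem_ofPred_eq ▸ ht'.1).le) (by
        rw [Prod.dist_eq]
        refine max_lt ?_ ht'.2
        simpa [abs_of_pos hε.1] using hε.2)
    calc _ ≤ dist (B ((s : ℂ), t')) (B ((s : ℂ), t)) +
          dist (B ((s : ℂ) + ε * Complex.I, t')) (B ((s : ℂ), t)) := dist_triangle_right _ _ _
      _ < η := by linarith
  refine hlu.differentiableOn ?_ hopen
  refine eventually_mem_nhdsWithin.mono fun ε hε => ?_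
  have hε' : 0 < ε := hε
  have hd : DifferentiableOn ℂ (fun t => F ((s : ℂ) + ε * Complex.I) t) {t | 0 < t.im} := by
    refine hF.comp (f := fun t : ℂ => ((s : ℂ) + ε * Complex.I, t)) (by fun_prop) fun t ht => ?_
    have ht' : 0 < t.im := ht
    apply mem_mandelstamDomain_of_im
    · simpa using hε'.ne'
    · exact ht'.ne'
    · simp
      linarith
  refine hd.congr fun t ht => ?_
  have ht' : 0 < t.im := ht
  rw [hB]
  simp only [tube, mem_ofPred_eq]
  simp
  exact ⟨hε', ht', by linarith⟩

/-- The boundary values of `F` at `s + i0` from both sides of the real `t`-axis agree between the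
`t`- and the `u`-cut: they are compared through the thin tube `Im s > 0`, `Im t, Im u < 0`. -/
theorem boundaryValue_crossing_of_lt (hμ : 0 < μ) (hF : IsAmplitude μ F)
    (hcut : DifferentiableOn ℂ (fun p : ℂ × ℂ => F p.1 p.2) (cutDomain 4 t₁ t₁))
    (hB : ∀ p ∈ tube 1 1 (-1), B p = F p.1 p.2)
    (hBc : ContinuousOn B (closure (tube 1 1 (-1)))) {s t u : ℝ} (hu : u = 4 - s - t)
    (ht1 : t < t₁) (hu1 : u < t₁) : B (s, t) = B (s, u) := by
  obtain ⟨B₂, hB₂, hol₂⟩ := hF.holder 1 (by simp) (-1) (by simp) (-1) (by simp)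
  have hB₂c : ContinuousOn B₂ (closure (tube 1 (-1) (-1))) := continuousOn_of_holder hμ hol₂
  have hsne : ∀ ε : ℝ, 0 < ε → (s : ℂ) + ε * Complex.I ∉ cut 4 := fun ε hε =>
    notMem_cut_of_im_ne_zero (by simpa using hε.ne')
  have hdom : ∀ ε : ℝ, 0 < ε → ∀ x : ℝ, x < t₁ →
      ((s : ℂ) + ε * Complex.I, (x : ℂ)) ∈ cutDomain 4 t₁ t₁ := fun ε hε x hx =>
    ⟨hsne ε hε, notMem_cut_of_re_lt (by simpa using hx),
      notMem_cut_of_im_ne_zero (by simpa using hε.ne')⟩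
  have hdom' : ∀ ε : ℝ, 0 < ε →
      ((s : ℂ) + ε * Complex.I, (u : ℂ) - ε * Complex.I) ∈ cutDomain 4 t₁ t₁ := fun ε hε =>
    ⟨hsne ε hε, notMem_cut_of_im_ne_zero (by simpa using hε.ne'),
      notMem_cut_of_re_lt (by simp [hu]; linarith)⟩
  have hBF : ∀ ε : ℝ, 0 < ε → ∀ x : ℝ, x < t₁ →
      B ((s : ℂ) + ε * Complex.I, (x : ℂ)) = F ((s : ℂ) + ε * Complex.I) x := fun ε hε x hx =>
    eq_of_mem_closure (f := fun p : ℂ × ℂ => F p.1 p.2) hB hBc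
      (mem_closure_tube_upper (by simpa using hε.le) (by simp))
      (continuousAt_of_mem_cutDomain hcut (hdom ε hε x hx))
  have hB₂F : ∀ ε : ℝ, 0 < ε → ∀ x : ℝ, x < t₁ →
      B₂ ((s : ℂ) + ε * Complex.I, (x : ℂ)) = F ((s : ℂ) + ε * Complex.I) x := fun ε hε x hx =>
    eq_of_mem_closure (f := fun p : ℂ × ℂ => F p.1 p.2) hB₂ hB₂c
      (mem_closure_tube_middle (by simpa using hε.le) (by simp) (by simpa using hε.le))
      (continuousAt_of_mem_cutDomain hcut (hdom ε hε x hx))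
  have hB₂F' : ∀ ε : ℝ, 0 < ε → B₂ ((s : ℂ) + ε * Complex.I, (u : ℂ) - ε * Complex.I) =
      F ((s : ℂ) + ε * Complex.I) ((u : ℂ) - ε * Complex.I) := fun ε hε =>
    eq_of_mem_closure (f := fun p : ℂ × ℂ => F p.1 p.2) hB₂ hB₂c
      (mem_closure_tube_middle (by simpa using hε.le) (by simpa using hε.le) (by simp))
      (continuousAt_of_mem_cutDomain hcut (hdom' ε hε))
  -- crossing is assumed on the Mandelstam domain only; `t` or `u` may lie in `[4, t₁)`
  have hcross : ∀ ε : ℝ, 0 < ε → F ((s : ℂ) + ε * Complex.I) ((u : ℂ) - ε * Complex.I) =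
      F ((s : ℂ) + ε * Complex.I) t := by
    intro ε hε
    have c1 := continuousAt_of_mem_cutDomain hcut (hdom ε hε t ht1)
    have c2 := continuousAt_of_mem_cutDomain hcut (hdom' ε hε)
    have p1 : Tendsto (fun η : ℝ => ((s : ℂ) + ε * Complex.I, (t : ℂ) + η * Complex.I)) (𝓝[>] 0)
        (𝓝 ((s : ℂ) + ε * Complex.I, (t : ℂ))) := by
      have : Continuous fun η : ℝ => ((s : ℂ) + ε * Complex.I, (t : ℂ) + η * Complex.I) := by
        fun_prop
      simpa using (this.tendsto 0).mono_left nhdsWithin_le_nhds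
    have p2 : Tendsto (fun η : ℝ => ((s : ℂ) + ε * Complex.I,
        (u : ℂ) - ε * Complex.I - η * Complex.I)) (𝓝[>] 0)
        (𝓝 ((s : ℂ) + ε * Complex.I, (u : ℂ) - ε * Complex.I)) := by
      have : Continuous fun η : ℝ => ((s : ℂ) + ε * Complex.I,
          (u : ℂ) - ε * Complex.I - η * Complex.I) := by fun_prop
      simpa using (this.tendsto 0).mono_left nhdsWithin_le_nhds
    refine (tendsto_nhds_unique (c1.tendsto.comp p1) ((c2.tendsto.comp p2).congr' ?_)).symm
    refine eventually_mem_nhdsWithin.mono fun η hη => ?_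
    have hη' : 0 < η := hη
    have hm : ((s : ℂ) + ε * Complex.I, (t : ℂ) + η * Complex.I) ∈ mandelstamDomain := by
      apply mem_mandelstamDomain_of_im <;> simp
      · exact hε.ne'
      · exact hη'.ne'
      · linarith
    have := (hF.crossing _ _ hm).2.1
    simp only [Function.comp_apply]
    rw [this]
    congr 1
    rw [hu]
    push_cast
    ring
  have l1 := tendsto_of_path hBc (π := fun ε : ℝ => ((s : ℂ) + ε * Complex.I, (t : ℂ)))
    (by fun_prop) (mem_closure_tube_upper (by simp) (by simp))
    (eventually_mem_nhdsWithin.mono fun ε hε => mem_closure_tube_upper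
      (by simpa using (mem_Ioi.1 hε).le) (by simp))
  have l2 := tendsto_of_path hBc (π := fun ε : ℝ => ((s : ℂ) + ε * Complex.I, (u : ℂ)))
    (by fun_prop) (mem_closure_tube_upper (by simp) (by simp))
    (eventually_mem_nhdsWithin.mono fun ε hε => mem_closure_tube_upper
      (by simpa using (mem_Ioi.1 hε).le) (by simp))
  have l3 := tendsto_of_path hB₂c (π := fun ε : ℝ => ((s : ℂ) + ε * Complex.I, (u : ℂ)))
    (by fun_prop) (mem_closure_tube_middle (by simp) (by simp) (by simp))
    (eventually_mem_nhdsWithin.mono fun ε hε => mem_closure_tube_middle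
      (by simpa using (mem_Ioi.1 hε).le) (by simp) (by simpa using (mem_Ioi.1 hε).le))
  have l4 := tendsto_of_path hB₂c
    (π := fun ε : ℝ => ((s : ℂ) + ε * Complex.I, (u : ℂ) - ε * Complex.I))
    (by fun_prop) (mem_closure_tube_middle (by simp) (by simp) (by simp))
    (eventually_mem_nhdsWithin.mono fun ε hε => mem_closure_tube_middle
      (by simpa using (mem_Ioi.1 hε).le) (by simpa using (mem_Ioi.1 hε).le) (by simp))
  simp only [Complex.ofReal_zero, zero_mul, add_zero, sub_zero] at l1 l2 l3 l4
  have e23 : B (s, u) = B₂ (s, u) := tendsto_nhds_unique l2 (l3.congr'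
    (eventually_mem_nhdsWithin.mono fun ε hε => (hB₂F ε hε u hu1).trans (hBF ε hε u hu1).symm))
  rw [e23]
  exact tendsto_nhds_unique l1 (l4.congr' (eventually_mem_nhdsWithin.mono fun ε hε => 
    ((hB₂F' ε hε).trans (hcross ε hε)).trans (hBF ε hε t ht1).symm))

theorem boundaryValue_crossing (hμ : 0 < μ) (hF : IsAmplitude μ F)
    (hcut : DifferentiableOn ℂ (fun p : ℂ × ℂ => F p.1 p.2) (cutDomain 4 t₁ t₁))
    (hB : ∀ p ∈ tube 1 1 (-1), B p = F p.1 p.2)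
    (hBc : ContinuousOn B (closure (tube 1 1 (-1)))) {s t : ℝ}
    (ht1 : t ≤ t₁) (hu1 : 4 - s - t < t₁) : B (s, t) = B (s, ((4 - s - t : ℝ) : ℂ)) := by
  rcases ht1.lt_or_eq with h | rfl
  · exact boundaryValue_crossing_of_lt hμ hF hcut hB hBc rfl h hu1
  · have l1 := tendsto_of_path hBc (π := fun ε : ℝ => ((s : ℂ), ((t - ε : ℝ) : ℂ)))
      (by fun_prop) (mem_closure_tube_upper (by simp) (by simp))
      (Eventually.of_forall fun ε => mem_closure_tube_upper (by simp) (by simp))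
    have l2 := tendsto_of_path hBc (π := fun ε : ℝ => ((s : ℂ), ((4 - s - (t - ε) : ℝ) : ℂ)))
      (by fun_prop) (mem_closure_tube_upper (by simp) (by simp))
      (Eventually.of_forall fun ε => mem_closure_tube_upper (by simp) (by simp))
    simp only [sub_zero] at l1 l2
    refine tendsto_nhds_unique l1 (l2.congr' ?_)
    filter_upwards [eventually_pos_lt (by linarith : 0 < t - (4 - s - t))] with ε hε
    exact (boundaryValue_crossing_of_lt hμ hF hcut hB hBc rfl (by linarith [hε.1])
      (by linarith [hε.2])).symm

end boundary

/-! ### Absence of the double spectral function near threshold -/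

/-- The Schwarz lemma in the second variable: it is uniform in the first one, because `G` is
bounded up to the cut `[4, ∞)`. No boundary values of `G` are needed. -/
theorem tendsto_sub_second_variable {G : ℂ → ℂ → ℂ}
    (hG : DifferentiableOn ℂ (fun p : ℂ × ℂ => G p.1 p.2) mandelstamHalfDomain)
    (hGb : PolynomiallyBoundedOn G mandelstamHalfDomain) {p q : ℝ → ℂ} {q₀ R : ℝ} (hq₀ : q₀ < 16)
    (hq : Tendsto q (𝓝[>] 0) (𝓝 q₀)) (hp : ∀ᶠ ε in 𝓝[>] (0 : ℝ), p ε ∉ cut 4 ∧ ‖p ε‖ ≤ R) :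
    Tendsto (fun ε => G (p ε) (q ε) - G (p ε) q₀) (𝓝[>] 0) (𝓝 0) := by
  obtain ⟨C, n, hC⟩ := hGb
  set d := 16 - q₀ with hd
  have hd0 : 0 < d := by rw [hd]; linarith
  set M := |C| * (1 + R + (|q₀| + d)) ^ n with hM
  have hre : ∀ z ∈ Metric.ball (q₀ : ℂ) d, z ∉ cut 16 := by
    intro z hz
    refine notMem_cut_of_re_lt ?_
    rw [mem_ball_iff_norm] at hz
    have h1 := (le_abs_self _).trans (Complex.abs_re_le_norm (z - q₀))
    simp at h1
    linarith
  have hlim : Tendsto (fun ε => (M + M) / d * dist (q ε) q₀) (𝓝[>] 0) (𝓝 0) := by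
    simpa using (tendsto_iff_dist_tendsto_zero.1 hq).const_mul ((M + M) / d)
  refine squeeze_zero_norm' ?_ hlim
  filter_upwards [hp, hq.eventually (Metric.ball_mem_nhds _ hd0)] with ε hε hqε
  have hR : 0 ≤ R := (norm_nonneg _).trans hε.2
  have hbd : ∀ z ∈ Metric.ball (q₀ : ℂ) d, ‖G (p ε) z‖ ≤ M := by
    intro z hz
    have hz1 : ‖z‖ ≤ |q₀| + d := by
      rw [mem_ball_iff_norm] at hz
      have := norm_sub_norm_le z q₀
      rw [Complex.norm_real, Real.norm_eq_abs] at this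
      linarith
    refine (hC _ _ ⟨hε.1, hre z hz⟩).trans ?_
    refine mul_le_mul (le_abs_self C) (pow_le_pow_left₀ (by positivity) ?_ n) (by positivity)
      (abs_nonneg C)
    linarith [hε.2]
  rw [← dist_eq_norm]
  refine Complex.dist_le_div_mul_dist_of_mapsTo_ball (f := fun z => G (p ε) z) (c := (q₀ : ℂ))
    (R₁ := d) (R₂ := M + M) ?_ ?_ hqε
  · exact hG.comp (f := fun z : ℂ => (p ε, z)) (by fun_prop) fun z hz => ⟨hε.1, hre z hz⟩
  · intro z hz
    rw [mem_closedBall_iff_norm]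
    exact (norm_sub_le _ _).trans (add_le_add (hbd z hz) (hbd _ (Metric.mem_ball_self hd0)))

/-- Approaching the real point `(s, t)` with `s, t < 16` and `u < 4` in the direction `(σ, τ)`,
the part of `F` that may have no limit depends on `σ` alone or on `τ` alone. -/
theorem tendsto_sub_of_mandelstamForm {F G : ℂ → ℂ → ℂ}
    (hG : DifferentiableOn ℂ (fun p : ℂ × ℂ => G p.1 p.2) mandelstamHalfDomain)
    (hGb : PolynomiallyBoundedOn G mandelstamHalfDomain)
    (hFG : ∀ s t : ℂ, (s, t) ∈ mandelstamDomain → F s t = crossingSym G s t) {s t u : ℝ}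
    (hu : u = 4 - s - t) (hs : s < 16) (ht : t < 16) (hu4 : u < 4) {σ τ : ℝ} (hσ : σ ≠ 0)
    (hτ : τ ≠ 0) (hστ : σ + τ ≠ 0) :
    Tendsto (fun ε : ℝ => F (s + σ * ε * Complex.I) (t + τ * ε * Complex.I) -
      (G (s + σ * ε * Complex.I) t + G (s + σ * ε * Complex.I) u +
        (G (t + τ * ε * Complex.I) s + G (t + τ * ε * Complex.I) u))) (𝓝[>] 0)
      (𝓝 (G u s + G u t)) := by
  have hpath : ∀ x κ : ℝ, Tendsto (fun ε : ℝ => (x : ℂ) + κ * ε * Complex.I) (𝓝[>] 0)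
      (𝓝 (x : ℂ)) := by
    intro x κ
    have : Continuous fun ε : ℝ => (x : ℂ) + κ * ε * Complex.I := by fun_prop
    simpa using (this.tendsto 0).mono_left nhdsWithin_le_nhds
  have hoff : ∀ x κ : ℝ, κ ≠ 0 → ∀ᶠ ε : ℝ in 𝓝[>] 0,
      (x : ℂ) + κ * ε * Complex.I ∉ cut 4 ∧ ‖(x : ℂ) + κ * ε * Complex.I‖ ≤ ‖(x : ℂ)‖ + 1 := by
    intro x κ hκ
    have h1 : ∀ᶠ ε : ℝ in 𝓝[>] 0, ‖(x : ℂ) + κ * ε * Complex.I‖ < ‖(x : ℂ)‖ + 1 :=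
      (hpath x κ).norm.eventually (gt_mem_nhds (by linarith))
    filter_upwards [h1, eventually_mem_nhdsWithin] with ε h2 h3
    have h4 : ε ≠ 0 := (mem_Ioi.1 h3).ne'
    exact ⟨notMem_cut_of_im_ne_zero (by simp [hκ, h4]), h2.le⟩
  have hu' : (4 : ℂ) - s - t = u := by rw [hu]; push_cast; ring
  have hup : ∀ ε : ℝ, (4 : ℂ) - (s + σ * ε * Complex.I) - (t + τ * ε * Complex.I) =
      u + ((-(σ + τ) : ℝ) : ℂ) * ε * Complex.I := by
    intro ε
    rw [← hu']
    push_cast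
    ring
  have hu16 : u < 16 := by linarith
  have L1 := tendsto_sub_second_variable hG hGb ht (hpath t τ) (hoff s σ hσ)
  have L2 := tendsto_sub_second_variable hG hGb hs (hpath s σ) (hoff t τ hτ)
  have L3 := tendsto_sub_second_variable hG hGb hu16 (hpath u (-(σ + τ))) (hoff s σ hσ)
  have L6 := tendsto_sub_second_variable hG hGb hu16 (hpath u (-(σ + τ))) (hoff t τ hτ)
  have hopen : IsOpen mandelstamHalfDomain :=
    ((isClosed_cut 4).isOpen_compl.preimage continuous_fst).inter
      ((isClosed_cut 16).isOpen_compl.preimage continuous_snd)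
  have hcont : ∀ x κ : ℝ, x < 16 → Tendsto (fun ε : ℝ =>
      G (u + ((-(σ + τ) : ℝ) : ℂ) * ε * Complex.I) (x + κ * ε * Complex.I)) (𝓝[>] 0)
      (𝓝 (G u x)) := by
    intro x κ hx
    have h1 : ContinuousAt (fun p : ℂ × ℂ => G p.1 p.2) ((u : ℂ), (x : ℂ)) :=
      hG.continuousOn.continuousAt (hopen.mem_nhds
        ⟨notMem_cut_of_re_lt (by simpa using hu4), notMem_cut_of_re_lt (by simpa using hx)⟩)
    exact h1.tendsto.comp ((hpath u _).prodMk_nhds (hpath x κ))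
  have hall := ((L1.add L2).add (L3.add L6)).add ((hcont s σ hs).add (hcont t τ ht))
  simp only [add_zero, zero_add] at hall
  refine hall.congr' ?_
  filter_upwards [eventually_mem_nhdsWithin] with ε hε
  have hε' : ε ≠ 0 := (mem_Ioi.1 hε).ne'
  have hm : ((s : ℂ) + σ * ε * Complex.I, (t : ℂ) + τ * ε * Complex.I) ∈ mandelstamDomain := by
    apply mem_mandelstamDomain_of_im <;> simp
    · exact ⟨hσ, hε'⟩
    · exact ⟨hτ, hε'⟩
    · rw [← add_mul]
      exact mul_ne_zero hστ hε'
  rw [hFG _ _ hm, crossingSym, hup]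
  ring

/-- Below `s = 16` and `t = 16` the double spectral function vanishes: the double difference of
`F` over the `s`- and the `t`-cut tends to zero. -/
theorem re_jump_eq_zero {F : ℂ → ℂ → ℂ} {μ : ℝ} {B : ℂ × ℂ → ℂ} (hF : IsAmplitude μ F)
    (hM : HasMandelstamForm F) (hB : ∀ p ∈ tube 1 1 (-1), B p = F p.1 p.2)
    (hBc : ContinuousOn B (closure (tube 1 1 (-1)))) {s t u : ℝ} (hu : u = 4 - s - t)
    (hs : s < 16) (ht : t < 16) (hu4 : u < 4) : (B (s, t) - B (s, u)).re = 0 := by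
  obtain ⟨G, hG, hGb, hFG⟩ := hM
  have hlim : ∀ x κ : ℝ, 0 < κ → Tendsto (fun ε : ℝ =>
      F ((s : ℂ) + ε * Complex.I) (x + κ * ε * Complex.I)) (𝓝[>] 0) (𝓝 (B (s, x))) := by
    intro x κ hκ
    have l := tendsto_of_path hBc
      (π := fun ε : ℝ => ((s : ℂ) + ε * Complex.I, (x : ℂ) + κ * ε * Complex.I))
      (by fun_prop) (mem_closure_tube_upper (by simp) (by simp))
      (eventually_mem_nhdsWithin.mono fun ε hε => mem_closure_tube_upper
        (by simpa using (mem_Ioi.1 hε).le) (by simpa using (mul_pos hκ (mem_Ioi.1 hε)).le))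
    simp only [Complex.ofReal_zero, zero_mul, mul_zero, add_zero] at l
    refine l.congr' (eventually_mem_nhdsWithin.mono fun ε hε => hB _ ?_)
    have h1 : 0 < ε := hε
    have h2 := mul_pos hκ h1
    simp only [tube, mem_ofPred_eq]
    simp
    exact ⟨h1, h2, by linarith⟩
  have hu' : (u : ℂ) = 4 - s - t := by rw [hu]; push_cast; ring
  have l1 := hlim t 2 two_pos
  have l2 : Tendsto (fun ε : ℝ => F ((s : ℂ) + ε * Complex.I) (t + ((-2 : ℝ) : ℂ) * ε * Complex.I))
      (𝓝[>] 0) (𝓝 (B (s, u))) := by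
    refine (hlim u 1 one_pos).congr' (eventually_mem_nhdsWithin.mono fun ε hε => ?_)
    have h1 : 0 < ε := hε
    have hm : ((s : ℂ) + ε * Complex.I, (u : ℂ) + (1 : ℝ) * ε * Complex.I) ∈ mandelstamDomain := by
      apply mem_mandelstamDomain_of_im <;> simp
      · exact h1.ne'
      · exact h1.ne'
      · linarith
    simp only
    rw [(hF.crossing _ _ hm).2.1]
    congr 1
    rw [hu']
    push_cast
    ring
  have hconj : ∀ (κ : ℝ) (b : ℂ), κ ≠ 0 → 1 + κ ≠ 0 → Tendsto (fun ε : ℝ =>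
      F ((s : ℂ) + ε * Complex.I) (t + (κ : ℂ) * ε * Complex.I)) (𝓝[>] 0) (𝓝 b) →
      Tendsto (fun ε : ℝ => F ((s : ℂ) + ((-1 : ℝ) : ℂ) * ε * Complex.I)
        (t + ((-κ : ℝ) : ℂ) * ε * Complex.I)) (𝓝[>] 0) (𝓝 (starRingEnd ℂ b)) := by
    intro κ b hκ hκ1 h
    refine ((Complex.continuous_conj.tendsto _).comp h).congr'
      (eventually_mem_nhdsWithin.mono fun ε hε => ?_)
    have h1 : 0 < ε := hε
    have hm : ((s : ℂ) + ε * Complex.I, (t : ℂ) + (κ : ℂ) * ε * Complex.I) ∈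
        mandelstamDomain := by
      apply mem_mandelstamDomain_of_im <;> simp
      · exact h1.ne'
      · exact ⟨hκ, h1.ne'⟩
      · rw [← one_add_mul]
        exact mul_ne_zero hκ1 h1.ne'
    rw [Function.comp_apply, ← hF.real_analytic _ _ hm]
    simp
  have l3 := hconj 2 _ (by norm_num) (by norm_num) l1
  have l4 := hconj (-2) _ (by norm_num) (by norm_num) l2
  have d1 := tendsto_sub_of_mandelstamForm hG hGb hFG hu hs ht hu4 (σ := 1) (τ := 2)
    (by norm_num) (by norm_num) (by norm_num)
  have d2 := tendsto_sub_of_mandelstamForm hG hGb hFG hu hs ht hu4 (σ := 1) (τ := -2)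
    (by norm_num) (by norm_num) (by norm_num)
  have d3 := tendsto_sub_of_mandelstamForm hG hGb hFG hu hs ht hu4 (σ := -1) (τ := -2)
    (by norm_num) (by norm_num) (by norm_num)
  have d4 := tendsto_sub_of_mandelstamForm hG hGb hFG hu hs ht hu4 (σ := -1) (τ := 2)
    (by norm_num) (by norm_num) (by norm_num)
  rw [neg_neg] at l4
  have e := tendsto_nhds_unique ((l1.sub l2).add (l3.sub l4))
    (((d1.sub d2).add (d3.sub d4)).congr fun ε => by
      simp only [Complex.ofReal_one, one_mul]
      ring)
  have e' := congrArg Complex.re e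
  simp at e'
  simp only [Complex.sub_re]
  linarith

/-! ### The functions `Φ` -/

section Phi

variable {μ v s : ℝ} (l : ℕ)

theorem one_lt_cosine (hs : 4 < s) {t : ℝ} (ht : 0 < t) : 1 < 1 + 2 * t / (s - 4) := by
  have : 0 < 2 * t / (s - 4) := div_pos (by linarith) (by linarith)
  linarith

theorem cosine_mono (hs : 4 < s) {t t' : ℝ} (h : t ≤ t') :
    1 + 2 * t / (s - 4) ≤ 1 + 2 * t' / (s - 4) := by
  have : 0 < s - 4 := by linarith
  gcongr

theorem intervalIntegrable_Phi (hμ : 0 < μ) (hv : 0 < v) (hs : 4 < s) :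
    IntervalIntegrable (fun t : ℝ => (t - v) ^ μ * legendreQ l (1 + 2 * t / (s - 4))) volume
      v (v + 1) := by
  have h1 : AntitoneOn (fun t : ℝ => legendreQ l (1 + 2 * t / (s - 4))) (uIcc v (v + 1)) := by
    intro t ht t' _ htt'
    rw [uIcc_of_le (by linarith)] at ht
    exact legendreQ_anti l (one_lt_cosine hs (hv.trans_le ht.1)) (cosine_mono hs htt')
  refine h1.intervalIntegrable.continuousOn_mul (Continuous.continuousOn ?_)
  exact (continuous_id.sub continuous_const).rpow_const fun _ => Or.inr hμ.le

theorem integral_sub_rpow (hμ : 0 < μ) : ∫ t in v..(v + 1), (t - v) ^ μ = 1 / (μ + 1) := by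
  have := intervalIntegral.integral_comp_sub_right (a := v) (b := v + 1) (fun t : ℝ => t ^ μ) v
  rw [this, sub_self, add_sub_cancel_left, integral_rpow (Or.inl (by linarith))]
  simp [Real.zero_rpow (by linarith : μ + 1 ≠ 0)]

/-- The contribution of the square, `Q_l` at the far end of the integration interval of `Φ`, is
dominated by `Φ` because `Q_l` is decreasing. -/
theorem legendreQ_le_Phi (hμ : 0 < μ) (hv : 0 < v) (hs : 4 < s) :
    legendreQ l (1 + 2 * (v + 1) / (s - 4)) ≤ (μ + 1) * Phi μ l v s := by
  have hc : Continuous fun t : ℝ => (t - v) ^ μ :=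
    (continuous_id.sub continuous_const).rpow_const fun _ => Or.inr hμ.le
  have h : ∫ t in v..(v + 1), (t - v) ^ μ * legendreQ l (1 + 2 * (v + 1) / (s - 4)) ≤
      ∫ t in v..(v + 1), (t - v) ^ μ * legendreQ l (1 + 2 * t / (s - 4)) := by
    refine intervalIntegral.integral_mono_on (by linarith)
      ((hc.intervalIntegrable _ _).mul_const _) (intervalIntegrable_Phi l hμ hv hs) fun t ht => ?_
    exact mul_le_mul_of_nonneg_left
      (legendreQ_anti l (one_lt_cosine hs (hv.trans_le ht.1)) (cosine_mono hs ht.2))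
      (Real.rpow_nonneg (by linarith [ht.1]) _)
  rw [intervalIntegral.integral_mul_const, integral_sub_rpow hμ] at h
  rw [Phi, if_neg hs.ne', ← div_le_iff₀' (by linarith)]
  linarith [one_div_mul_eq_div (μ + 1) (legendreQ l (1 + 2 * (v + 1) / (s - 4)))]

theorem Phi_nonneg (hv : 0 < v) (hs : 4 ≤ s) : 0 ≤ Phi μ l v s := by
  rw [Phi]
  split_ifs with h
  · exact le_rfl
  · have hs' : 4 < s := lt_of_le_of_ne hs (Ne.symm h)
    refine intervalIntegral.integral_nonneg (by linarith) fun t ht => ?_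
    exact mul_nonneg (Real.rpow_nonneg (by linarith [ht.1]) _)
      (legendreQ_nonneg l (one_lt_cosine hs' (hv.trans_le ht.1)))

/-- `Φ = O(s - 4)` uniformly in `l`; this pays for the phase space factor in `|f_l|²`. -/
theorem Phi_le (hμ : 0 < μ) (hv : 4 ≤ v) (hs : 4 < s) : Phi μ l v s ≤ (s - 4) / 8 := by
  rw [Phi, if_neg hs.ne']
  have hs' : 0 < s - 4 := by linarith
  calc _ ≤ ∫ t in v..(v + 1), (s - 4) / 8 := by
        refine intervalIntegral.integral_mono_on (by linarith)
          (intervalIntegrable_Phi l hμ (by linarith) hs) intervalIntegrable_const fun t ht => ?_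
        have ht4 : 4 ≤ t := hv.trans ht.1
        have h1 : (t - v) ^ μ ≤ 1 :=
          Real.rpow_le_one (by linarith [ht.1]) (by linarith [ht.2]) hμ.le
        have h0 := one_lt_cosine hs (by linarith : 0 < t)
        have h2 : legendreQ l (1 + 2 * t / (s - 4)) ≤ (s - 4) / 8 := by
          refine (legendreQ_le l h0).trans ?_
          rw [add_sub_cancel_left, one_div_div]
          gcongr
          linarith
        calc _ ≤ 1 * ((s - 4) / 8) :=
              mul_le_mul h1 h2 (legendreQ_nonneg l h0) zero_le_one
          _ = _ := one_mul _
    _ = _ := by simp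

end Phi

/-! ### Estimates of the partial waves -/

/-- The phase space factor `(1/2) (s (s - 4))^(-1/2)` compared with `((s - 4) / s)^(-1/2)`. -/
theorem phaseSpace_eq {s : ℝ} (hs : 4 < s) :
    (s * (s - 4)) ^ (-(1 / 2) : ℝ) = s⁻¹ * ((s - 4) / s) ^ (-(1 / 2) : ℝ) := by
  have h0 : 0 < s := by linarith
  have h1 : 0 < s - 4 := by linarith
  rw [show s * (s - 4) = s ^ (2 : ℝ) * ((s - 4) / s) by rw [Real.rpow_two]; field_simp,
    Real.mul_rpow (by positivity) (by positivity), ← Real.rpow_mul h0.le]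
  norm_num [Real.rpow_neg_one]

theorem rpow_neg_half_mul_sqrt {x : ℝ} (hx : 0 < x) : x ^ (-(1 / 2) : ℝ) * √x = 1 := by
  rw [Real.sqrt_eq_rpow, ← Real.rpow_add hx]
  norm_num

theorem partialWave_four (F : ℂ → ℂ → ℂ) (l : ℕ) : partialWave F l 4 = 0 := by
  simp [partialWave]

theorem Phi_four (μ : ℝ) (l : ℕ) (v : ℝ) : Phi μ l v 4 = 0 := by simp [Phi]

section amplitude

variable {F : ℂ → ℂ → ℂ} {μ t₁ : ℝ} {B : ℂ × ℂ → ℂ}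

/-- The partial wave as a Legendre coefficient in `x = cos θ = 1 + 2 t / (s - 4)`. -/
theorem partialWave_eq (hF : DifferentiableOn ℂ (fun p : ℂ × ℂ => F p.1 p.2) mandelstamDomain)
    (hB : ∀ p ∈ tube 1 1 (-1), B p = F p.1 p.2)
    (hBc : ContinuousOn B (closure (tube 1 1 (-1)))) (l : ℕ) {s : ℝ} (hs : 4 < s) :
    partialWave F l s =
      (((1 / 2) * (s * (s - 4)) ^ (-(1 / 2) : ℝ) * ((s - 4) / 2) : ℝ) : ℂ) *
      ∫ x : ℝ in (-1 : ℝ)..1, B (s, (((s - 4) / 2 : ℝ) : ℂ) * (x - 1)) * (legendreP l x : ℂ) := by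
  have hs' : s - 4 ≠ 0 := by linarith
  have h1 : ∫ t in (4 - s)..0, above F s (t : ℂ) * ((legendreP l (1 + 2 * t / (s - 4)) : ℝ) : ℂ) =
      ∫ t in (4 - s)..0, B (s, (t : ℂ)) * ((legendreP l (1 + 2 * t / (s - 4)) : ℝ) : ℂ) := by
    refine intervalIntegral.integral_congr fun t ht => ?_
    rw [uIcc_of_le (by linarith)] at ht
    rw [above_eq hF hB hBc s (by simp) (notMem_cut_of_re_lt (by simp; linarith [ht.2]))]
  have h2 := intervalIntegral.smul_integral_comp_mul_add (fun t : ℝ =>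
    B (s, (t : ℂ)) * ((legendreP l (1 + 2 * t / (s - 4)) : ℝ) : ℂ)) (a := -1) (b := 1)
    ((s - 4) / 2) (-((s - 4) / 2))
  rw [partialWave, h1, show 4 - s = (s - 4) / 2 * -1 + -((s - 4) / 2) by ring,
    show (0 : ℝ) = (s - 4) / 2 * 1 + -((s - 4) / 2) by ring, ← h2, Complex.real_smul, ← mul_assoc,
    ← Complex.ofReal_mul]
  congr 1
  refine intervalIntegral.integral_congr fun x _ => ?_
  congr 3
  · push_cast
    ring_nf
  · field_simp
    ring

theorem continuousOn_boundaryValue_comp (hBc : ContinuousOn B (closure (tube 1 1 (-1)))) {s : ℝ}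
    (hs : 4 < s) (S : Set ℂ) (hS : ∀ z ∈ S, 0 ≤ z.im) :
    ContinuousOn (fun z : ℂ => B (s, (((s - 4) / 2 : ℝ) : ℂ) * (z - 1))) S := by
  refine hBc.comp (f := fun z : ℂ => ((s : ℂ), (((s - 4) / 2 : ℝ) : ℂ) * (z - 1)))
    (by fun_prop) fun z hz => mem_closure_tube_upper (by simp) ?_
  simp only [Complex.im_ofReal_mul, Complex.sub_im, Complex.one_im, sub_zero]
  exact mul_nonneg (by linarith) (hS z hz)

theorem differentiableOn_boundaryValue_comp
    (hF : DifferentiableOn ℂ (fun p : ℂ × ℂ => F p.1 p.2) mandelstamDomain)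
    (hB : ∀ p ∈ tube 1 1 (-1), B p = F p.1 p.2)
    (hBc : ContinuousOn B (closure (tube 1 1 (-1)))) {s : ℝ} (hs : 4 < s) :
    DifferentiableOn ℂ (fun z : ℂ => B (s, (((s - 4) / 2 : ℝ) : ℂ) * (z - 1))) {z | 0 < z.im} := by
  refine (differentiableOn_boundaryValue hF hB hBc s).comp
    (f := fun z : ℂ => (((s - 4) / 2 : ℝ) : ℂ) * (z - 1)) (by fun_prop) fun z hz => ?_
  have hz' : 0 < z.im := hz
  simp only [mem_ofPred_eq, Complex.im_ofReal_mul, Complex.sub_im, Complex.one_im, sub_zero]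
  exact mul_pos (by linarith) hz'

/-- The square of the contour estimate stays in a bounded region of the `t`-plane as `s → 4`. -/
theorem norm_map_square_le {s T : ℝ} (hs : 4 < s) (hT : 0 < T) {z : ℂ}
    (hz : z ∈ Icc (-(1 + 2 * T / (s - 4))) (1 + 2 * T / (s - 4)) ×ℂ Icc 0 (1 + 2 * T / (s - 4))) :
    ‖(((s - 4) / 2 : ℝ) : ℂ) * (z - 1)‖ ≤ 2 * s + 2 * T := by
  have hs' : 0 < s - 4 := by linarith
  set X := 1 + 2 * T / (s - 4) with hX
  have hXm : (s - 4) / 2 * X = (s - 4) / 2 + T := by rw [hX]; field_simp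
  have h1 : ‖z - 1‖ ≤ 2 * X + 1 := by
    have h2 := norm_sub_le z 1
    have h3 := Complex.norm_le_abs_re_add_abs_im z
    have h4 : |z.re| ≤ X := abs_le.2 hz.1
    have h5 : |z.im| ≤ X := abs_le.2 ⟨by linarith [hz.2.1, hz.2.2], hz.2.2⟩
    rw [norm_one] at h2
    linarith
  rw [norm_mul, Complex.norm_real, Real.norm_of_nonneg (by linarith)]
  calc _ ≤ (s - 4) / 2 * (2 * X + 1) := mul_le_mul_of_nonneg_left h1 (by linarith)
    _ = 2 * ((s - 4) / 2 * X) + (s - 4) / 2 := by ring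
    _ ≤ _ := by rw [hXm]; linarith

/-- The contour estimate for the square in the `cos θ`-plane whose side
corresponds to `t = t₁ + 1`, the jump over the `t`-cut being bounded by Hölder continuity. -/
theorem exists_norm_partialWave_le (hμ : 0 < μ) (ht₁ : 4 ≤ t₁) (hF : IsAmplitude μ F)
    (hcut : DifferentiableOn ℂ (fun p : ℂ × ℂ => F p.1 p.2) (cutDomain 4 t₁ t₁)) {s₁ : ℝ}
    (hs₁ : 4 ≤ s₁) :
    ∃ c : ℝ, 0 ≤ c ∧ ∀ (l : ℕ) (s : ℝ), 4 < s → s ≤ s₁ →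
      ‖partialWave F l s‖ ≤ c * ((s - 4) / s) ^ (-(1 / 2) : ℝ) * Phi μ l t₁ s := by
  obtain ⟨B, hB, hol⟩ := hF.holder 1 (by simp) 1 (by simp) (-1) (by simp)
  have hBc := continuousOn_of_holder hμ hol
  set R := 2 * s₁ + 2 * (t₁ + 1) with hR
  have hR0 : 0 ≤ R := by rw [hR]; linarith
  obtain ⟨C, hC⟩ := hol R
  set N := |C| with hN
  have hN0 : 0 ≤ N := abs_nonneg C
  have hH : ∀ p ∈ closure (tube 1 1 (-1)), ∀ q ∈ closure (tube 1 1 (-1)), ‖p‖ ≤ R → ‖q‖ ≤ R →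
      ‖B p - B q‖ ≤ N * ‖p - q‖ ^ μ := fun p hp q hq h1 h2 =>
    (hC p hp q hq h1 h2).trans (mul_le_mul_of_nonneg_right (le_abs_self C)
      (Real.rpow_nonneg (norm_nonneg _) _))
  set K := ‖B (0, 0)‖ + N * R ^ μ with hK
  have hRμ : 0 ≤ R ^ μ := Real.rpow_nonneg hR0 _
  have hK0 : 0 ≤ K := by positivity
  have hbd : ∀ p ∈ closure (tube 1 1 (-1)), ‖p‖ ≤ R → ‖B p‖ ≤ K := by
    intro p hp hpR
    have h1 := hH p hp (0, 0) (mem_closure_tube_upper (by simp) (by simp)) hpR (by simpa using hR0)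
    have h2 : ‖p - (0, 0)‖ = ‖p‖ := by rw [← Prod.zero_eq_mk, sub_zero]
    rw [h2] at h1
    have h3 : ‖p‖ ^ μ ≤ R ^ μ := Real.rpow_le_rpow (norm_nonneg _) hpR hμ.le
    have h4 := norm_sub_norm_le (B p) (B (0, 0))
    have h5 := mul_le_mul_of_nonneg_left h3 hN0
    linarith
  refine ⟨4 * (s₁ + t₁ + 1) * K * (μ + 1) + 2 * N, by positivity, fun l s hs hss => ?_⟩
  have hs0 : 0 < s - 4 := by linarith
  have ht0 : 0 < t₁ := by linarith
  set h := (s - 4) / 2 with hh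
  have hh0 : 0 < h := by rw [hh]; linarith
  set X := 1 + 2 * (t₁ + 1) / (s - 4) with hX
  set x₁ := 1 + 2 * t₁ / (s - 4) with hx
  have hx1 : 1 < x₁ := one_lt_cosine hs ht0
  have hxX : x₁ ≤ X := cosine_mono hs (by linarith)
  have hX1 : 1 < X := hx1.trans_le hxX
  have hhX : h * X = h + (t₁ + 1) := by rw [hX, hh]; field_simp
  have hhx : h * x₁ = h + t₁ := by rw [hx, hh]; field_simp
  have hcoord : ∀ x : ℝ, (h : ℂ) * (x - 1) = ((h * (x - 1) : ℝ) : ℂ) := fun x => by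
    push_cast; rfl
  have hcoord' : ∀ x : ℝ, (h : ℂ) * (-x - 1) = ((4 - s - h * (x - 1) : ℝ) : ℂ) := fun x => by
    rw [hh]; push_cast; ring
  set f : ℝ → ℝ := fun t => (t - t₁) ^ μ * legendreQ l (1 + 2 * t / (s - 4)) with hf
  have hfi := intervalIntegrable_Phi l hμ ht0 hs
  have hji : IntervalIntegrable (fun x : ℝ => 2 * N * f (h * x + -h)) volume x₁ X := by
    have h1 := (hfi.comp_add_right (-h)).comp_mul_left (c := h)
    rw [show (t₁ - -h) / h = x₁ by rw [div_eq_iff hh0.ne']; linarith,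
      show (t₁ + 1 - -h) / h = X by rw [div_eq_iff hh0.ne']; linarith] at h1
    exact h1.const_mul _
  -- the jump integral over the `t`-cut is `Φ`, since `h * X - h = t₁ + 1`
  have hjint : h * ∫ x in x₁..X, 2 * N * f (h * x + -h) = 2 * N * Phi μ l t₁ s := by
    rw [intervalIntegral.integral_const_mul, Phi, if_neg hs.ne']
    have := intervalIntegral.smul_integral_comp_mul_add f (a := x₁) (b := X) h (-h)
    rw [show h * x₁ + -h = t₁ by linarith, show h * X + -h = t₁ + 1 by linarith,
      smul_eq_mul] at this
    rw [← this]
    ring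
  have hcl : ∀ t : ℝ, ((s : ℂ), (t : ℂ)) ∈ closure (tube 1 1 (-1)) := fun t =>
    mem_closure_tube_upper (by simp) (by simp)
  have hcrossing : ∀ x : ℝ, 0 ≤ x → x ≤ x₁ → B (s, (h : ℂ) * (x - 1)) =
      B (s, (h : ℂ) * (-x - 1)) := by
    intro x hx0 hxx
    rw [hcoord, hcoord']
    have h1 : h * x ≤ h * x₁ := mul_le_mul_of_nonneg_left hxx hh0.le
    have h2 : 0 ≤ h * x := mul_nonneg hh0.le hx0
    refine boundaryValue_crossing hμ hF hcut hB hBc ?_ ?_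
    · linarith
    · have : 4 - s = -(2 * h) := by rw [hh]; ring
      linarith
  have hmem : ∀ x : ℝ, x ∈ Icc (-X) X → (x : ℂ) ∈ Icc (-X) X ×ℂ Icc 0 X := fun x hx =>
    ⟨by simpa using hx, by simpa using (zero_lt_one.trans hX1).le⟩
  have hnorm : ∀ z ∈ Icc (-X) X ×ℂ Icc 0 X, ‖((s : ℂ), (h : ℂ) * (z - 1))‖ ≤ R := by
    intro z hz
    have h1 := norm_map_square_le hs (by linarith : 0 < t₁ + 1) hz
    refine max_le ?_ (h1.trans (by rw [hR]; linarith))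
    simp only [Complex.norm_real, Real.norm_eq_abs]
    rw [abs_of_pos (by linarith), hR]
    linarith
  have main := norm_integral_mul_legendreP_le
    (a := fun z : ℂ => B (s, (h : ℂ) * (z - 1))) (K := K) l hx1 hxX
    (continuousOn_boundaryValue_comp hBc hs _ fun z hz => hz.2.1)
    ((differentiableOn_boundaryValue_comp hF.holomorphic hB hBc hs).mono fun z hz => hz.2.1)
    hcrossing hK0
    (fun z hz hz0 => hbd _ (mem_closure_tube_upper (by simp) (by
      simp only [Complex.im_ofReal_mul, Complex.sub_im, Complex.one_im, sub_zero]
      positivity)) (hnorm z hz))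
    hji (by
      intro x hxx
      have hx0 : 0 < x := by linarith [hxx.1]
      have hd : 0 ≤ h * (x - 1) - t₁ := by
        have := mul_le_mul_of_nonneg_left hxx.1.le hh0.le
        linarith
      -- the jump vanishes at `x₁`, so both of its terms are compared with their values there
      have hstep : ∀ p q : ℂ × ℂ, p ∈ closure (tube 1 1 (-1)) → q ∈ closure (tube 1 1 (-1)) →
          ‖p‖ ≤ R → ‖q‖ ≤ R → ‖p - q‖ = h * (x - 1) - t₁ →
          ‖B p - B q‖ ≤ N * (h * (x - 1) - t₁) ^ μ := fun p q hp hq h1 h2 h3 => by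
        have := hH p hp q hq h1 h2
        rwa [h3] at this
      have e1 : (((h * (x₁ - 1) : ℝ) : ℂ)) = (t₁ : ℂ) := by
        congr 1; linarith
      have k1 : ‖B (s, (h : ℂ) * (x - 1)) - B (s, (h : ℂ) * (x₁ - 1))‖ ≤
          N * (h * (x - 1) - t₁) ^ μ := by
        refine hstep _ _ (by rw [hcoord]; exact hcl _) (by rw [hcoord]; exact hcl _)
          (hnorm _ (hmem x ⟨by linarith, hxx.2⟩)) (hnorm _ (hmem x₁ ⟨by linarith, hxX⟩)) ?_
        rw [hcoord, hcoord, Prod.mk_sub_mk, sub_self, Prod.norm_mk, norm_zero,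
          ← Complex.ofReal_sub, Complex.norm_real, max_eq_right (norm_nonneg _),
          Real.norm_of_nonneg (by linarith)]
        linarith
      have k2 : ‖B (s, (h : ℂ) * (-x₁ - 1)) - B (s, (h : ℂ) * (-x - 1))‖ ≤
          N * (h * (x - 1) - t₁) ^ μ := by
        have m1 := hnorm _ (hmem (-x₁) ⟨by linarith, by linarith⟩)
        have m2 := hnorm _ (hmem (-x) ⟨by linarith [hxx.2], by linarith⟩)
        rw [Complex.ofReal_neg] at m1 m2
        refine hstep _ _ (by rw [hcoord']; exact hcl _) (by rw [hcoord']; exact hcl _) m1 m2 ?_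
        rw [hcoord', hcoord', Prod.mk_sub_mk, sub_self, Prod.norm_mk, norm_zero,
          ← Complex.ofReal_sub, Complex.norm_real, max_eq_right (norm_nonneg _),
          Real.norm_of_nonneg (by linarith)]
        linarith
      have k3 := hcrossing x₁ (by linarith) le_rfl
      have k4 : ‖B (s, (h : ℂ) * (x - 1)) - B (s, (h : ℂ) * (-x - 1))‖ ≤
          2 * N * (h * (x - 1) - t₁) ^ μ := by
        have := norm_add_le (B (s, (h : ℂ) * (x - 1)) - B (s, (h : ℂ) * (x₁ - 1)))
          (B (s, (h : ℂ) * (-x₁ - 1)) - B (s, (h : ℂ) * (-x - 1)))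
        rw [← k3, sub_add_sub_cancel] at this
        rw [← k3] at k2
        linarith
      have e2 : 1 + 2 * (h * x + -h) / (s - 4) = x := by rw [hh]; field_simp; ring
      simp only [hf]
      rw [e2, show h * x + -h - t₁ = h * (x - 1) - t₁ by ring, ← mul_assoc]
      exact mul_le_mul_of_nonneg_right k4 (legendreQ_nonneg l (hx1.trans hxx.1)))
  rw [partialWave_eq hF.holomorphic hB hBc l hs, norm_mul, Complex.norm_real, phaseSpace_eq hs]
  set r := ((s - 4) / s) ^ (-(1 / 2) : ℝ) with hr
  have hr0 : 0 ≤ r := Real.rpow_nonneg (div_nonneg hs0.le (by linarith)) _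
  have hΦ := Phi_nonneg (μ := μ) l ht0 hs.le
  have hQ := legendreQ_le_Phi l hμ ht0 hs
  have hQ0 := legendreQ_nonneg l hX1
  have hsinv : s⁻¹ ≤ 1 / 4 := by
    rw [one_div]; exact inv_anti₀ (by norm_num) hs.le
  have hsinv0 : 0 ≤ s⁻¹ := inv_nonneg.2 (by linarith)
  rw [Real.norm_of_nonneg (by positivity)]
  set Φ := Phi μ l t₁ s with hΦd
  set Q := legendreQ l X with hQd
  calc _ ≤ 1 / 2 * (s⁻¹ * r) * h * (32 * (X * K * Q) +
        8 * ∫ x in x₁..X, 2 * N * f (h * x + -h)) := by gcongr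
    _ = s⁻¹ * r * (16 * (h * X) * K * Q + 4 * (h * ∫ x in x₁..X, 2 * N * f (h * x + -h))) := by
        ring
    _ = s⁻¹ * r * (16 * (h + (t₁ + 1)) * K * Q + 8 * N * Φ) := by rw [hjint, hhX]; ring
    _ ≤ 1 / 4 * r * (16 * (s₁ + t₁ + 1) * K * ((μ + 1) * Φ) + 8 * N * Φ) := by
        have : h + (t₁ + 1) ≤ s₁ + t₁ + 1 := by rw [hh]; linarith
        gcongr
    _ = _ := by ring

/-- With Mandelstam analyticity the absorptive part is regular in `t` well beyond `t = 4` as long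
as `s < 16`, so that near threshold the contour estimate applies to it without any cut. -/
theorem exists_abs_im_partialWave_le (hμ : 0 < μ) (hF : IsAmplitude μ F)
    (hthr : HasThresholdBound F) (hM : HasMandelstamForm F) :
    ∃ c : ℝ, 0 ≤ c ∧ ∀ (l : ℕ) (s : ℝ), 4 < s → s ≤ 5 →
      |(partialWave F l s).im| ≤ c * Phi μ l 4 s := by
  obtain ⟨B, hB, hol⟩ := hF.holder 1 (by simp) 1 (by simp) (-1) (by simp)
  have hBc := continuousOn_of_holder hμ hol
  obtain ⟨C, n, hC⟩ := hthr
  set K := |C| * (1 + 5 + (2 * 5 + 2 * 5)) ^ n with hK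
  have hK0 : 0 ≤ K := by positivity
  refine ⟨24 * K * (μ + 1), by positivity, fun l s hs hss => ?_⟩
  have hs0 : 0 < s - 4 := by linarith
  set h := (s - 4) / 2 with hh
  have hh0 : 0 < h := by rw [hh]; linarith
  set X := 1 + 2 * (4 + 1) / (s - 4) with hX
  have hX1 : 1 < X := one_lt_cosine hs (by norm_num)
  have hhX : h * X = h + 5 := by rw [hX, hh]; field_simp; ring
  have hcoord : ∀ x : ℝ, (h : ℂ) * (x - 1) = ((h * (x - 1) : ℝ) : ℂ) := fun x => by
    push_cast; rfl
  have hcoord' : ∀ x : ℝ, (h : ℂ) * (-x - 1) = ((4 - s - h * (x - 1) : ℝ) : ℂ) := fun x => by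
    rw [hh]; push_cast; ring
  set a : ℂ → ℂ := fun z => B (s, (h : ℂ) * (z - 1)) with ha
  -- `A` is the absorptive part: reflection and crossing give the boundary value at `s - i0`
  set A : ℂ → ℂ := fun z => (a z - starRingEnd ℂ (a (-starRingEnd ℂ z))) / (2 * Complex.I) with hA
  have hac : ∀ S : Set ℂ, (∀ z ∈ S, 0 ≤ z.im) → ContinuousOn a S :=
    continuousOn_boundaryValue_comp hBc hs
  have had : DifferentiableOn ℂ a {z | 0 < z.im} :=
    differentiableOn_boundaryValue_comp hF.holomorphic hB hBc hs
  have hopen : IsOpen {z : ℂ | 0 < z.im} := isOpen_lt continuous_const Complex.continuous_im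
  have hAc : ContinuousOn A (Icc (-X) X ×ℂ Icc 0 X) := by
    refine ((hac _ fun z hz => hz.2.1).sub (Complex.continuous_conj.comp_continuousOn
      ((hac {z | 0 ≤ z.im} fun z hz => hz).comp (by fun_prop) fun z hz => ?_))).div_const _
    have := hz.2.1
    simpa using this
  have hAd : DifferentiableOn ℂ A {z | 0 < z.im} := by
    intro z hz
    refine (((had.differentiableAt (hopen.mem_nhds hz)).sub ?_).div_const _).differentiableWithinAt
    have hz' : 0 < z.im := hz
    have h1 : DifferentiableAt ℂ (fun w => a (-w)) (starRingEnd ℂ z) := by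
      refine DifferentiableAt.comp (g := a) (f := fun w : ℂ => -w) _
        (had.differentiableAt (hopen.mem_nhds ?_)) (by fun_prop)
      simpa using hz'
    have h2 := h1.conj_conj
    rw [Complex.conj_conj] at h2
    exact h2
  have hAreal : ∀ x : ℝ, A x = (a x - starRingEnd ℂ (a (-x))) / (2 * Complex.I) := by
    intro x
    simp only [hA, Complex.conj_ofReal]
  have heven : ∀ x : ℝ, 0 ≤ x → x ≤ X → A x = A (-x) := by
    intro x hx0 hxX
    have h1 : h * x ≤ h * X := mul_le_mul_of_nonneg_left hxX hh0.le
    have h2 : 0 ≤ h * x := mul_nonneg hh0.le hx0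
    have hre := re_jump_eq_zero hF hM hB hBc (s := s) (t := h * (x - 1))
      (u := 4 - s - h * (x - 1)) rfl (by linarith) (by linarith)
      (by
        have : 4 - s = -(2 * h) := by rw [hh]; ring
        linarith)
    rw [← hcoord, ← hcoord'] at hre
    have h3 := hAreal (-x)
    rw [Complex.ofReal_neg, neg_neg] at h3
    rw [h3, hAreal]
    congr 1
    have h4 : (a x - a (-x)) + starRingEnd ℂ (a x - a (-x)) = 0 := by
      rw [Complex.add_conj, show (a x - a (-x)).re = 0 from hre]
      simp
    rw [map_sub] at h4
    linear_combination h4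
  have hAbd : ∀ z ∈ Icc (-X) X ×ℂ Icc 0 X, 0 < z.im → ‖A z‖ ≤ K * √((s - 4) / s) := by
    intro z hz hz0
    set t : ℂ := (h : ℂ) * (z - 1) with ht
    have him : t.im = h * z.im := by
      simp only [ht, Complex.im_ofReal_mul, Complex.sub_im, Complex.one_im, sub_zero]
    have htim : 0 < t.im := him ▸ mul_pos hh0 hz0
    have e : absorptivePart F s t = A z := by
      rw [absorptivePart, above_eq hF.holomorphic hB hBc s htim.le
        (notMem_cut_of_im_ne_zero htim.ne'), below_eq hF hB hBc s htim]
      simp only [hA, ha]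
      congr 5
      simp only [ht, map_mul, map_sub, Complex.conj_ofReal, map_one]
      rw [hh]
      push_cast
      ring_nf
    rw [← e]
    refine (hC s t hs.le (notMem_cut_of_im_ne_zero htim.ne')
      (notMem_cut_of_im_ne_zero (by simp; exact htim.ne'))).trans ?_
    have h1 : ‖t‖ ≤ 2 * 5 + 2 * 5 := by
      have := norm_map_square_le hs (by norm_num : (0 : ℝ) < 4 + 1) hz
      exact this.trans (by linarith)
    have h2 : |s| ≤ 5 := by rw [abs_of_pos (by linarith)]; exact hss
    calc _ ≤ |C| * √((s - 4) / s) * (1 + 5 + (2 * 5 + 2 * 5)) ^ n := by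
          gcongr
          exact le_abs_self C
      _ = _ := by rw [hK]; ring
  have main := norm_integral_mul_legendreP_le (a := A) (K := K * √((s - 4) / s)) (j := fun _ => 0)
    l hX1 le_rfl hAc (hAd.mono fun z hz => hz.2.1) heven (by positivity) hAbd
    intervalIntegrable_const (fun x hx => absurd hx.1 (not_lt.2 hx.2))
  rw [intervalIntegral.integral_same, mul_zero, add_zero] at main
  -- on the physical interval `A` is the imaginary part of the amplitude
  have hint : ∫ x : ℝ in (-1 : ℝ)..1, A x * (legendreP l x : ℂ) =
      (((∫ x : ℝ in (-1 : ℝ)..1, a x * (legendreP l x : ℂ)).im : ℝ) : ℂ) := by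
    have hi : IntervalIntegrable (fun x : ℝ => a x * (legendreP l x : ℂ)) volume (-1) 1 := by
      refine (ContinuousOn.mul ?_ (Complex.continuous_ofReal.comp
        (continuous_legendreP l)).continuousOn).intervalIntegrable
      exact (hac {z | 0 ≤ z.im} fun z hz => hz).comp (by fun_prop) fun x _ => by simp
    have h1 := Complex.imCLM.intervalIntegral_comp_comm hi
    simp only [Complex.imCLM_apply] at h1
    rw [← h1, ← intervalIntegral.integral_ofReal]
    refine intervalIntegral.integral_congr fun x hx => ?_
    rw [uIcc_of_le (by norm_num)] at hx
    have h2 : a x = a (-x) := by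
      simp only [ha]
      rw [hcoord, hcoord']
      have k1 : h * x ≤ h * 1 := mul_le_mul_of_nonneg_left hx.2 hh0.le
      have k2 : h * (-1) ≤ h * x := mul_le_mul_of_nonneg_left hx.1 hh0.le
      have : 4 - s = -(2 * h) := by rw [hh]; ring
      exact boundaryValue_crossing (t₁ := 4) hμ hF hF.holomorphic hB hBc (by linarith)
        (by linarith)
    rw [hAreal, ← h2, Complex.im_mul_ofReal, Complex.ofReal_mul]
    congr 1
    rw [Complex.sub_conj]
    field_simp
    push_cast
    rfl
  rw [hint, Complex.norm_real, Real.norm_eq_abs] at main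
  rw [partialWave_eq hF.holomorphic hB hBc l hs, Complex.im_ofReal_mul, abs_mul, phaseSpace_eq hs]
  set r := ((s - 4) / s) ^ (-(1 / 2) : ℝ) with hr
  have hdiv : 0 < (s - 4) / s := div_pos hs0 (by linarith)
  have hr0 : 0 ≤ r := Real.rpow_nonneg hdiv.le _
  have hΦ := Phi_nonneg (μ := μ) l (by norm_num : (0 : ℝ) < 4) hs.le
  have hQ := legendreQ_le_Phi (v := 4) l hμ (by norm_num) hs
  have hQ0 := legendreQ_nonneg l hX1
  have hsinv : s⁻¹ ≤ 1 / 4 := by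
    rw [one_div]; exact inv_anti₀ (by norm_num) hs.le
  have hsinv0 : 0 ≤ s⁻¹ := inv_nonneg.2 (by linarith)
  have hrs : r * √((s - 4) / s) = 1 := rpow_neg_half_mul_sqrt hdiv
  rw [abs_of_nonneg (by positivity : 0 ≤ 1 / 2 * (s⁻¹ * r) * h)]
  set Φ := Phi μ l 4 s with hΦd
  set Q := legendreQ l X with hQd
  calc _ ≤ 1 / 2 * (s⁻¹ * r) * h * (32 * (X * (K * √((s - 4) / s)) * Q)) := by gcongr
    _ = 16 * s⁻¹ * (h * X) * K * Q * (r * √((s - 4) / s)) := by ring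
    _ = 16 * s⁻¹ * (h + 5) * K * Q := by rw [hrs, hhX, mul_one]
    _ ≤ 16 * (1 / 4) * 6 * K * ((μ + 1) * Φ) := by
        have : h + 5 ≤ 6 := by rw [hh]; linarith
        gcongr
    _ = _ := by ring

/-- Below `t₁` there is no `s`-cut by crossing, so the partial waves are real. -/
theorem partialWave_im_eq_zero (hF : IsAmplitude μ F)
    (hcut : DifferentiableOn ℂ (fun p : ℂ × ℂ => F p.1 p.2) (cutDomain 4 t₁ t₁)) (l : ℕ) {s : ℝ}
    (hs : 4 < s) (hst : s < t₁) : (partialWave F l s).im = 0 := by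
  have key : ∀ t ∈ uIcc (4 - s) 0, (above F s (t : ℂ)).im = 0 := by
    intro t ht
    rw [uIcc_of_le (by linarith)] at ht
    have hc := continuousAt_of_mem_cutDomain (p := ((t : ℂ), (s : ℂ))) hcut
      ⟨notMem_cut_of_re_lt (by simp; linarith [ht.2]), notMem_cut_of_re_lt (by simpa using hst),
        notMem_cut_of_re_lt (by simp; linarith [ht.1])⟩
    have hlim : ∀ σ : ℝ, σ ≠ 0 → Tendsto (fun ε : ℝ => F ((s : ℂ) + σ * ε * Complex.I) t)
        (𝓝[>] 0) (𝓝 (F t s)) := by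
      intro σ hσ
      have h1 : Tendsto (fun ε : ℝ => ((t : ℂ), (s : ℂ) + σ * ε * Complex.I)) (𝓝[>] 0)
          (𝓝 ((t : ℂ), (s : ℂ))) := by
        have : Continuous fun ε : ℝ => ((t : ℂ), (s : ℂ) + σ * ε * Complex.I) := by fun_prop
        simpa using (this.tendsto 0).mono_left nhdsWithin_le_nhds
      refine (hc.tendsto.comp h1).congr' (eventually_mem_nhdsWithin.mono fun ε hε => ?_)
      have hε' : ε ≠ 0 := (mem_Ioi.1 hε).ne'
      refine ((hF.crossing ((s : ℂ) + σ * ε * Complex.I) t ⟨?_, ?_, ?_⟩).1).symm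
      · exact notMem_cut_of_im_ne_zero (by simp [hσ, hε'])
      · exact notMem_cut_of_re_lt (by simp; linarith [ht.2])
      · exact notMem_cut_of_im_ne_zero (by simp [hσ, hε'])
    have l1 := hlim 1 one_ne_zero
    have l2 := (Complex.continuous_conj.tendsto _).comp (hlim (-1) (by norm_num))
    have hab : above F s t = F t s := by
      refine Tendsto.limUnder_eq ?_
      simpa using l1
    rw [hab]
    refine Complex.conj_eq_iff_im.1 (tendsto_nhds_unique (l2.congr'
      (eventually_mem_nhdsWithin.mono fun ε hε => ?_)) l1)
    have hε' : ε ≠ 0 := (mem_Ioi.1 hε).ne'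
    rw [Function.comp_apply, ← hF.real_analytic _ _ ⟨?_, ?_, ?_⟩]
    · simp
    · exact notMem_cut_of_im_ne_zero (by simp [hε'])
    · exact notMem_cut_of_re_lt (by simp; linarith [ht.2])
    · exact notMem_cut_of_im_ne_zero (by simp [hε'])
  have e : ∫ t in (4 - s)..0, above F s (t : ℂ) * ((legendreP l (1 + 2 * t / (s - 4)) : ℝ) : ℂ) =
      ((∫ t in (4 - s)..0,
        (above F s (t : ℂ)).re * legendreP l (1 + 2 * t / (s - 4)) : ℝ) : ℂ) := by
    rw [← intervalIntegral.integral_ofReal]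
    refine intervalIntegral.integral_congr fun t ht => ?_
    rw [Complex.ofReal_mul]
    congr 1
    exact Complex.ext (by simp) (by simp [key t ht])
  rw [partialWave, e, ← Complex.ofReal_mul, Complex.ofReal_im]

end amplitude

theorem mainTheorem4 (F : ℂ → ℂ → ℂ) (μ t₁ s₁ : ℝ) (hμ₀ : 0 < μ) (hμ : μ ≤ 1 / 2)
    (ht₁ : 4 ≤ t₁) (hF : IsAmplitude μ F) (hthr : HasThresholdBound F)
    (hcut : DifferentiableOn ℂ (fun p : ℂ × ℂ => F p.1 p.2) (cutDomain 4 t₁ t₁))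
    (hM : t₁ = 4 → HasMandelstamForm F) (hs₁ : 4 ≤ s₁) :
    ∃ c₁ c₂ : ℝ, 0 ≤ c₁ ∧ 0 ≤ c₂ ∧
      (∀ (l : ℕ) (s : ℝ), 4 ≤ s → s ≤ s₁ →
        ‖partialWave F l s‖ ≤ c₁ * ((s - 4) / s) ^ (-(1 / 2) : ℝ) * Phi μ l t₁ s ∧
        |(partialWave F l s).im| ≤ c₂ * Phi μ l t₁ s) ∧
      ∀ γ : ℝ, ∃ c₃ : ℝ, 0 ≤ c₃ ∧
        ∀ (l : ℕ) (s : ℝ), 4 ≤ s → s ≤ s₁ →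
          -(c₃ * s ^ γ * Phi μ l t₁ s) ≤
            (partialWave F l s).im - 2 * ‖partialWave F l s‖ ^ 2 := by
  have ht0 : 0 < t₁ := by linarith
  obtain ⟨c₁, hc₁, h1⟩ := exists_norm_partialWave_le hμ₀ ht₁ hF hcut hs₁
  -- away from threshold the second estimate follows from the first
  have haway : ∀ v : ℝ, 4 < v → ∃ c : ℝ, 0 ≤ c ∧ ∀ (l : ℕ) (s : ℝ), v ≤ s → s ≤ s₁ →
      |(partialWave F l s).im| ≤ c * Phi μ l t₁ s := by
    intro v hv
    have hpos : 0 < (v - 4) / s₁ := div_pos (by linarith) (by linarith)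
    refine ⟨c₁ * ((v - 4) / s₁) ^ (-(1 / 2) : ℝ), by positivity, fun l s hvs hss => ?_⟩
    have hr : ((s - 4) / s) ^ (-(1 / 2) : ℝ) ≤ ((v - 4) / s₁) ^ (-(1 / 2) : ℝ) := by
      refine Real.rpow_le_rpow_of_nonpos hpos ?_ (by norm_num)
      exact div_le_div₀ (by linarith) (by linarith) (by linarith) hss
    have hΦ := Phi_nonneg (μ := μ) (s := s) l ht0 (by linarith)
    refine (Complex.abs_im_le_norm _).trans ((h1 l s (by linarith) hss).trans ?_)
    gcongr
  have h2 : ∃ c₂ : ℝ, 0 ≤ c₂ ∧ ∀ (l : ℕ) (s : ℝ), 4 < s → s ≤ s₁ →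
      |(partialWave F l s).im| ≤ c₂ * Phi μ l t₁ s := by
    rcases ht₁.eq_or_lt with h4 | h4
    · obtain ⟨c, hc, hnear⟩ := exists_abs_im_partialWave_le hμ₀ hF hthr (hM h4.symm)
      obtain ⟨c', hc', hfar⟩ := haway 5 (by norm_num)
      refine ⟨c + c', add_nonneg hc hc', fun l s hs hss => ?_⟩
      have hΦ := Phi_nonneg (μ := μ) l ht0 hs.le
      rcases le_total s 5 with h5 | h5
      · have := hnear l s hs h5
        rw [h4] at this
        exact this.trans (mul_le_mul_of_nonneg_right (by linarith) hΦ)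
      · exact (hfar l s h5 hss).trans (mul_le_mul_of_nonneg_right (by linarith) hΦ)
    · obtain ⟨c', hc', hfar⟩ := haway t₁ h4
      refine ⟨c', hc', fun l s hs hss => ?_⟩
      rcases lt_or_ge s t₁ with h5 | h5
      · rw [partialWave_im_eq_zero hF hcut l hs h5, abs_zero]
        exact mul_nonneg hc' (Phi_nonneg l ht0 hs.le)
      · exact hfar l s h5 hss
  obtain ⟨c₂, hc₂, h2⟩ := h2
  refine ⟨c₁, c₂, hc₁, hc₂, fun l s hs hss => ?_, fun γ => ?_⟩
  · rcases hs.eq_or_lt with rfl | hs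
    · simp [partialWave_four, Phi_four]
    · exact ⟨h1 l s hs hss, h2 l s hs hss⟩
  set m := min ((4 : ℝ) ^ γ) (s₁ ^ γ) with hm
  have hm0 : 0 < m := lt_min (Real.rpow_pos_of_pos (by norm_num) _)
    (Real.rpow_pos_of_pos (by linarith) _)
  refine ⟨(c₂ + c₁ ^ 2 * s₁ / 4) / m, by positivity, fun l s hs hss => ?_⟩
  rcases hs.eq_or_lt with rfl | hs
  · simp [partialWave_four, Phi_four]
  have hs0 : 0 < s := by linarith
  have hs4 : 0 < s - 4 := by linarith
  have hmγ : m ≤ s ^ γ := by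
    rcases le_total 0 γ with hγ | hγ
    · exact (min_le_left _ _).trans (Real.rpow_le_rpow (by norm_num) hs.le hγ)
    · exact (min_le_right _ _).trans (Real.rpow_le_rpow_of_nonpos hs0 hss hγ)
  have hΦ := Phi_nonneg (μ := μ) l ht0 hs.le
  have hΦle := Phi_le (μ := μ) l hμ₀ ht₁ hs
  set Φ := Phi μ l t₁ s with hΦd
  -- the phase space factor is absorbed by one factor `Φ = O(s - 4)`
  have hsq : ‖partialWave F l s‖ ^ 2 ≤ c₁ ^ 2 * s₁ / 8 * Φ := by
    have hrr : (((s - 4) / s) ^ (-(1 / 2) : ℝ)) ^ 2 = s / (s - 4) := by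
      rw [← Real.rpow_natCast, ← Real.rpow_mul (by positivity)]
      norm_num [Real.rpow_neg_one]
    calc _ ≤ (c₁ * ((s - 4) / s) ^ (-(1 / 2) : ℝ) * Φ) ^ 2 :=
          pow_le_pow_left₀ (norm_nonneg _) (h1 l s hs hss) 2
      _ = c₁ ^ 2 * (s / (s - 4)) * Φ * Φ := by rw [← hrr]; ring
      _ ≤ c₁ ^ 2 * (s / (s - 4)) * Φ * ((s - 4) / 8) := by gcongr
      _ = c₁ ^ 2 * s / 8 * Φ := by field_simp
      _ ≤ _ := by gcongr
  have him := (abs_le.1 (h2 l s hs hss)).1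
  have h3 : (c₂ + c₁ ^ 2 * s₁ / 4) * Φ ≤ (c₂ + c₁ ^ 2 * s₁ / 4) / m * s ^ γ * Φ := by
    refine mul_le_mul_of_nonneg_right ?_ hΦ
    rw [div_mul_eq_mul_div, le_div_iff₀ hm0]
    gcongr
  linarith
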